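/- Let $d\in\{2,3\}$, let $D\subset\mathbb R^d$ be open, and let $S=\{\mu\in\mathbb R^d:|\mu|_2=1\}$ carry its surface measure $d\mu$. Let $\theta:D\times[-1,1]\to[0,\infty)$ be a measurable (mono-energetic) scattering kernel such that $$\beta(x)=\int_S\theta(x,\mu\cdot\mu')\,d\mu'$$ (which does not depend on $\mu\in S$) is finite for every $x\in D$ and essentially bounded on $D$. Put $$s(w,v)=\int_S\int_D\Big(\int_S\theta(x,\mu'\cdot\mu)\,w(x,\mu')\,d\mu'\Big)v(x,\mu)\,dx\,d\mu,\qquad m(w,v)=\int_S\int_D\beta(x)\,w(x,\mu)\,v(x,\mu)\,dx\,d\mu .$$ Let $P_\ell$ ($\ell\ge 0$) denote the Legendre polynomials normalised as reproducing kernels of the spherical harmonics of degree $\ell$ on $S$: for $d=3$, $P_\ell$ is $\frac{2\ell+1}{4\pi}$ times the classical Legendre polynomial of degree $\ell$; for $d=2$, $P_0=\frac1{2\pi}$ and $P_\ell=\frac1\pi T_\ell$ for $\ell\ge1$, with $T_\ell$ the Chebyshev polynomial, $T_\ell(\cos\varphi)=\cos\ell\varphi$. Suppose that there are functions $\theta_\ell:D\to\mathbb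 R$ with $$\theta(x,\mu\cdot\mu')=\sum_{\ell=0}^\infty\theta_\ell(x)\,P_\ell(\mu\cdot\mu'),$$ where for every $x\in D$ and $\mu\in S$ the series converges in the sense of distributions in $\mu'\in S$ (for example uniformly, or in $L_p(S)$ for some $p\ge1$). Let $\omega\in\mathbb R$ and $$r(\theta,\omega)=\sup\Big\{\Big|\frac{\theta_\ell(x)}{\beta(x)}-\omega\Big| : \ell\ge0,\ x\in D\Big\},$$ where the quotient is read as $0$ at points with $\beta(x)=0$ and the supremum as $0$ if $D=\emptyset$. Then $r(\theta,\omega)$ is finite, and for all real $w,v\in L_2(D\times S)$ the integrals defining $s(w,v)$ and $m(w,v)$ converge absolutely and $$|s(w,v)-\omega\,m(w,v)|\le r(\theta,\omega)\,m(w,w)^{1/2}\,m(v,v)^{1/2}.$$ -/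

import Mathlib

open MeasureTheory Filter Topology

/-- The space `ℝᵈ` with its Euclidean norm. -/
abbrev Space (d : ℕ) : Type := EuclideanSpace ℝ (Fin d)

/-- The angular domain: the unit sphere of `ℝᵈ`. -/
abbrev Angle (d : ℕ) : Type := Metric.sphere (0 : Space d) 1

/-- The surface measure of the unit sphere (total mass `2π` for `d = 2` and `4π` for `d = 3`). -/
noncomputable def surf (d : ℕ) : Measure (Angle d) :=
  (volume : Measure (Space d)).toSphere

instance surf_isFiniteMeasure (d : ℕ) : IsFiniteMeasure (surf d) := by
  unfold surf; infer_instance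

/-- The cosine `μ · μ'` of the angle between two directions. -/
noncomputable def dotp {d : ℕ} (μ μ' : Angle d) : ℝ :=
  inner ℝ (μ : Space d) (μ' : Space d)

/-- The product measure `dx dμ` on `D × S`. -/
noncomputable def phaseMeasure (d : ℕ) (D : Set (Space d)) : Measure (Space d × Angle d) :=
  ((volume : Measure (Space d)).restrict D).prod (surf d)

/-- The scattering operator `S[w](x, μ) = ∫_S θ(x, μ'·μ) w(x, μ') dμ'`. -/
noncomputable def scatterOp {d : ℕ} (θ : Space d → ℝ → ℝ) (w : Space d × Angle d → ℝ)
    (x : Space d) (μ : Angle d) : ℝ :=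
  ∫ μ', θ x (dotp μ' μ) * w (x, μ') ∂(surf d)

/-- The scattering form `s(w, v) = ∫_S ∫_D S[w] v dx dμ`. -/
noncomputable def scatterForm {d : ℕ} (D : Set (Space d)) (θ : Space d → ℝ → ℝ)
    (w v : Space d × Angle d → ℝ) : ℝ :=
  ∫ μ, (∫ x in D, scatterOp θ w x μ * v (x, μ)) ∂(surf d)

/-- The macroscopic scattering cross-section `β(x) = ∫_S θ(x, μ·μ') dμ'`. This integral does not
depend on the direction `μ` (see `crossSection_eq`); the definition averages over `μ` in order
not to single out a direction. -/
noncomputable def crossSection {d : ℕ} (θ : Space d → ℝ → ℝ) (x : Space d) : ℝ :=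
  ⨍ μ, (∫ μ', θ x (dotp μ μ') ∂(surf d)) ∂(surf d)

/-- The weighted mass form `m(w, v) = ∫_S ∫_D β(x) w(x, μ) v(x, μ) dx dμ`. -/
noncomputable def massForm {d : ℕ} (D : Set (Space d)) (θ : Space d → ℝ → ℝ)
    (w v : Space d × Angle d → ℝ) : ℝ :=
  ∫ μ, (∫ x in D, crossSection θ x * w (x, μ) * v (x, μ)) ∂(surf d)

/-- The classical Legendre polynomials, through Bonnet's recursion
`(n + 2) P_{n+2} = (2n + 3) X P_{n+1} - (n + 1) P_n`. -/
noncomputable def legendrePoly : ℕ → Polynomial ℝ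
  | 0 => 1
  | 1 => Polynomial.X
  | n + 2 => Polynomial.C (1 / ((n : ℝ) + 2)) *
      (Polynomial.C (2 * (n : ℝ) + 3) * Polynomial.X * legendrePoly (n + 1)
        - Polynomial.C ((n : ℝ) + 1) * legendrePoly n)

/-- The Legendre polynomials of the sphere in `ℝᵈ`, `d = 2, 3`, in the normalisation in which
`P_ℓ(μ·μ')` is the sum `∑ₘ Yₗₘ(μ) Yₗₘ(μ')` over an orthonormal basis of the spherical harmonics of
degree `ℓ`: for `d = 3` this is `(2ℓ + 1)/(4π)` times the classical Legendre polynomial, and for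
`d = 2` it is `1/(2π)` for `ℓ = 0` and `1/π` times the Chebyshev polynomial `T_ℓ` for `ℓ ≥ 1`. -/
noncomputable def normLegendre (d ℓ : ℕ) (t : ℝ) : ℝ :=
  if d = 2 then (if ℓ = 0 then 1 / (2 * Real.pi) else 1 / Real.pi) *
    (Polynomial.Chebyshev.T ℝ (ℓ : ℤ)).eval t
  else (2 * (ℓ : ℝ) + 1) / (4 * Real.pi) * (legendrePoly ℓ).eval t

/-- `θ(x, μ·μ') = ∑_ℓ θ_ℓ(x) P_ℓ(μ·μ')` for all `x ∈ D` and directions `μ`, where the partial sums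
converge in the sense of distributions on the sphere in the variable `μ'`, that is, when tested
against (restrictions to the sphere of) smooth functions. This is the weakest of the usual modes
of convergence; uniform convergence or convergence in some `Lᵖ` of the sphere implies it. -/
def HasLegendreExpansion {d : ℕ} (D : Set (Space d)) (θ : Space d → ℝ → ℝ)
    (θc : ℕ → Space d → ℝ) : Prop :=
  ∀ x ∈ D, ∀ μ : Angle d, ∀ g : Space d → ℝ, ContDiff ℝ ((⊤ : ℕ∞) : WithTop ℕ∞) g →
    Tendsto (fun N : ℕ => ∫ μ' : Angle d,
        (∑ ℓ ∈ Finset.range N, θc ℓ x * normLegendre d ℓ (dotp μ μ')) * g μ' ∂(surf d))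
      atTop (𝓝 (∫ μ' : Angle d, θ x (dotp μ μ') * g μ' ∂(surf d)))

/-- The numbers `|θ_ℓ(x)/β(x) - ω|`, `ℓ ≥ 0`, `x ∈ D`. Where `β(x) = 0`, Lean's convention makes
the quotient `0`. -/
def deviations {d : ℕ} (D : Set (Space d)) (θ : Space d → ℝ → ℝ) (θc : ℕ → Space d → ℝ)
    (ω : ℝ) : Set ℝ :=
  {r | ∃ ℓ : ℕ, ∃ x ∈ D, r = |θc ℓ x / crossSection θ x - ω|}

/-- The factor `r(θ, ω)`, the supremum of `|θ_ℓ(x)/β(x) - ω|` over `ℓ ≥ 0` and `x ∈ D`. -/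
noncomputable def contractionFactor {d : ℕ} (D : Set (Space d)) (θ : Space d → ℝ → ℝ)
    (θc : ℕ → Space d → ℝ) (ω : ℝ) : ℝ :=
  sSup (deviations D θ θc ω)

/-- The action of a linear isometry on directions. -/
noncomputable def rotAngle {d : ℕ} (L : Space d ≃ₗᵢ[ℝ] Space d) (μ : Angle d) : Angle d :=
  ⟨L μ, by simp⟩

/-- The surface measure is invariant under linear isometries. -/
theorem surf_map_rotAngle {d : ℕ} (L : Space d ≃ₗᵢ[ℝ] Space d) :
    MeasurePreserving (rotAngle L) (surf d) (surf d) := by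
  have hc : Continuous (rotAngle L) := by
    unfold rotAngle
    fun_prop
  refine ⟨hc.measurable, ?_⟩
  ext s hs
  rw [Measure.map_apply hc.measurable hs, surf, Measure.toSphere_apply' _ (hc.measurable hs),
    Measure.toSphere_apply' _ hs]
  congr 1
  conv_rhs => rw [← L.measurePreserving.measure_preimage_equiv (f := L.toMeasurableEquiv)]
  congr 1
  ext y
  simp only [Set.mem_smul, Set.mem_image, Set.mem_preimage]
  constructor
  · rintro ⟨r, hr, _, ⟨μ, hμ, rfl⟩, rfl⟩
    refine ⟨r, hr, _, ⟨rotAngle L μ, hμ, rfl⟩, ?_⟩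
    exact (L.map_smul r (μ : Space d)).symm
  · rintro ⟨r, hr, _, ⟨μ, hμ, rfl⟩, h⟩
    refine ⟨r, hr, _, ⟨rotAngle L.symm μ, ?_, rfl⟩, ?_⟩
    · have : rotAngle L (rotAngle L.symm μ) = μ := by ext1; simp [rotAngle]
      simpa [this] using hμ
    · apply L.injective
      have h' : r • (μ : Space d) = L y := h
      simpa [rotAngle] using h'

/-- The integral `∫_S f(μ·μ') dμ'` does not depend on the direction `μ`. -/
theorem integral_dotp_eq {d : ℕ} (f : ℝ → ℝ) (μ ν : Angle d) :
    ∫ μ', f (dotp μ μ') ∂(surf d) = ∫ μ', f (dotp ν μ') ∂(surf d) := by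
  have hn : ‖(μ : Space d)‖ = ‖(ν : Space d)‖ := by simp
  let L : Space d ≃ₗᵢ[ℝ] Space d :=
    Submodule.reflection (Submodule.span ℝ {(μ : Space d) - (ν : Space d)})ᗮ
  have hL : L (μ : Space d) = ν := Submodule.reflection_sub hn
  have hcL : Continuous (rotAngle L) := by unfold rotAngle; fun_prop
  have hinj : Function.LeftInverse (rotAngle L.symm) (rotAngle L) := by
    intro x; ext1; simp [rotAngle]
  have hcL' : Continuous (rotAngle L.symm) := by unfold rotAngle; fun_prop
  have hemb : MeasurableEmbedding (rotAngle L) :=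
    MeasurableEmbedding.of_measurable_inverse hcL.measurable
      (by
        have : Set.range (rotAngle L) = Set.univ := by
          apply Set.eq_univ_of_forall
          intro x
          exact ⟨rotAngle L.symm x, by ext1; simp [rotAngle]⟩
        rw [this]; exact MeasurableSet.univ) hcL'.measurable hinj
  rw [← (surf_map_rotAngle L).integral_comp hemb (fun μ' => f (dotp ν μ'))]
  congr 1
  ext μ'
  congr 1
  simp only [dotp, rotAngle, ← hL]
  exact (L.inner_map_map _ _).symm

/-- `β(x) = ∫_S θ(x, μ·μ') dμ'` for every direction `μ`. -/
theorem crossSection_eq {d : ℕ} (θ : Space d → ℝ → ℝ) (x : Space d) (μ : Angle d) :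
    crossSection θ x = ∫ μ', θ x (dotp μ μ') ∂(surf d) := by
  have hne : Nontrivial (Space d) := ⟨(μ : Space d), 0, by
    intro h
    have := μ.2
    simp [h] at this⟩
  have : NeZero (surf d) := ⟨by unfold surf; exact Measure.toSphere_ne_zero _⟩
  unfold crossSection
  rw [show (fun ν : Angle d => ∫ μ', θ x (dotp ν μ') ∂(surf d))
      = fun _ => ∫ μ', θ x (dotp μ μ') ∂(surf d) from
    funext fun ν => integral_dotp_eq (θ x) ν μ]
  exact average_const _ _

/-! At a fixed point x the scattering operator on S commutes with rotations, so the spherical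
harmonics of degree ℓ are eigenfunctions, and the eigenvalue is θ_ℓ(x). Harmonics of different
degree are orthogonal and all of them together are dense in L²(S). Hence the operator minus ωβ(x)
has norm at most sup_ℓ |θ_ℓ(x) - ωβ(x)| ≤ r β(x) on L²(S) (`ZonalKernel.abs_form_sub_le`). Writing β
= √β √β and applying Cauchy–Schwarz in x gives the estimate. The factor r is finite because a
nonnegative kernel of mass β has norm at most β (`ZonalKernel.abs_form_le`), whence |θ_ℓ(x)| ≤ β(x).

The theory of harmonics is derived from rotation invariance of the surface measure alone.
Differentiating that invariance gives a divergence theorem on the sphere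
(`integral_tangential_divergence`). Applied to products p(μ·σ) q(ν·σ), it yields recursions that
prove the Funk–Hecke formula for polynomial kernels (`integral_poly_mul_zonalPoly`), and from it the
reproducing and orthogonality relations of the P_ℓ (`integral_normLegendre_mul`). Harmonics are
handled as the span of zonal functions P_ℓ(ν·σ). Their density comes from Stone–Weierstrass for the
exponentials exp⟨y, σ⟩ (`iSup_harmonics_topologicalClosure`). Testing the expansion of θ against a
zonal function identifies its coefficients as eigenvalues (`HasLegendreExpansion.eigenvalue`). -/

/-! ### Rotation invariance of surface integrals. -/

theorem continuous_rotAngle {d : ℕ} (L : Space d ≃ₗᵢ[ℝ] Space d) : Continuous (rotAngle L) := by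
  unfold rotAngle
  fun_prop

theorem integral_rotAngle {d : ℕ} (L : Space d ≃ₗᵢ[ℝ] Space d) {f : Angle d → ℝ}
    (hf : Continuous f) :
    ∫ σ, f (rotAngle L σ) ∂(surf d) = ∫ σ, f σ ∂(surf d) := by
  have h := surf_map_rotAngle L
  conv_rhs => rw [← h.map_eq]
  exact (integral_map h.measurable.aemeasurable hf.aestronglyMeasurable).symm

theorem integrable_surf_of_continuous {d : ℕ} {f : Angle d → ℝ} (hf : Continuous f) :
    Integrable f (surf d) := by
  obtain ⟨C, hC⟩ := isCompact_univ.exists_bound_of_continuousOn (f := f) hf.continuousOn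
  exact Integrable.of_bound hf.aestronglyMeasurable C
    (Eventually.of_forall fun x => hC x (Set.mem_univ x))

/-! ### Half-turns and the divergence theorem on the sphere. -/

/-- The half-turn `x ↦ 2⟨u, x⟩/‖u‖² u - x` about the line spanned by `u = a + s b`. -/
noncomputable def halfTurn {d : ℕ} (a b : Space d) (s : ℝ) (x : Space d) : Space d :=
  (2 * inner ℝ (a + s • b) x / ‖a + s • b‖ ^ 2) • (a + s • b) - x

/-- The derivative of `halfTurn a b s x` in `s`. -/
noncomputable def halfTurnDeriv {d : ℕ} (a b : Space d) (s : ℝ) (x : Space d) : Space d :=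
  (2 * inner ℝ (a + s • b) x / ‖a + s • b‖ ^ 2) • b +
    ((2 * inner ℝ b x * ‖a + s • b‖ ^ 2 - 2 * inner ℝ (a + s • b) x * (2 * inner ℝ (a + s • b) b))
      / (‖a + s • b‖ ^ 2) ^ 2) • (a + s • b)

theorem halfTurn_eq_reflection {d : ℕ} (a b : Space d) (s : ℝ) (x : Space d) :
    halfTurn a b s x = (Submodule.span ℝ {a + s • b}).reflection x := by
  rw [Submodule.reflection_singleton_apply, halfTurn, two_smul, ← add_smul]
  congr 2
  simp
  ring

theorem hasDerivAt_halfTurn {d : ℕ} (a b x : Space d) (s : ℝ) (hs : a + s • b ≠ 0) :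
    HasDerivAt (fun s => halfTurn a b s x) (halfTurnDeriv a b s x) s := by
  have h1 : HasDerivAt (fun s : ℝ => a + s • b) b s := by
    simpa using ((hasDerivAt_id s).smul_const b).const_add a
  have h2 : HasDerivAt (fun s : ℝ => ‖a + s • b‖ ^ 2) (2 * inner ℝ (a + s • b) b) s :=
    h1.norm_sq
  have h3 : HasDerivAt (fun s : ℝ => 2 * inner ℝ (a + s • b) x) (2 * inner ℝ b x) s := by
    have := (h1.inner ℝ (hasDerivAt_const s x)).const_mul 2
    simpa using this
  have h4 := ((h3.div h2 (by positivity)).smul h1).sub_const x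
  exact h4

theorem continuousOn_halfTurn {d : ℕ} (a b : Space d) :
    ContinuousOn (fun p : ℝ × Angle d => halfTurn a b p.1 p.2)
      ({s | a + s • b ≠ 0} ×ˢ Set.univ) := by
  rintro ⟨s, σ⟩ ⟨hs, -⟩
  have : ‖a + s • b‖ ^ 2 ≠ 0 := by
    have : a + s • b ≠ 0 := hs
    positivity
  refine ContinuousAt.continuousWithinAt ?_
  unfold halfTurn
  fun_prop (disch := assumption)

theorem continuousOn_halfTurnDeriv {d : ℕ} (a b : Space d) :
    ContinuousOn (fun p : ℝ × Angle d => halfTurnDeriv a b p.1 p.2)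
      ({s | a + s • b ≠ 0} ×ˢ Set.univ) := by
  rintro ⟨s, σ⟩ ⟨hs, -⟩
  have h1 : ‖a + s • b‖ ^ 2 ≠ 0 := by
    have : a + s • b ≠ 0 := hs
    positivity
  have h2 : (‖a + s • b‖ ^ 2) ^ 2 ≠ 0 := pow_ne_zero 2 h1
  refine ContinuousAt.continuousWithinAt ?_
  unfold halfTurnDeriv
  fun_prop (disch := assumption)

/-- Infinitesimal rotation invariance. The integral of h over the sphere composed with the half-turn
about a + s b is constant in s, and its derivative at s = 0 is computed under the integral.
Half-turns have an explicit rational formula, valid in every dimension and without assuming a ⊥ b.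
-/
theorem integral_fderiv_skew {d : ℕ} {h : Space d → ℝ} (hh : ContDiff ℝ 1 h) (a b : Space d)
    (ha : ‖a‖ = 1) :
    ∫ σ : Angle d, fderiv ℝ h σ (inner ℝ a (σ : Space d) • b - inner ℝ b (σ : Space d) • a)
      ∂(surf d) = 0 := by
  -- For |s| ≤ ε one has ‖s b‖ ≤ 1/2 < ‖a‖, so the axis a + s b does not degenerate.
  set ε : ℝ := 1 / (2 * (‖b‖ + 1)) with hε
  have hb0 := norm_nonneg b
  have hεpos : 0 < ε := by positivity
  have hne : ∀ s ∈ Metric.closedBall (0 : ℝ) ε, a + s • b ≠ 0 := by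
    intro s hs h0
    have hs' : |s| ≤ ε := by simpa using hs
    have h1 : ‖a‖ = |s| * ‖b‖ := by
      rw [eq_neg_of_add_eq_zero_left h0, norm_neg, norm_smul, Real.norm_eq_abs]
    have h2 : |s| * ‖b‖ ≤ ε * (‖b‖ + 1) := by gcongr; linarith
    have h3 : ε * (‖b‖ + 1) = 1 / 2 := by rw [hε]; field_simp
    linarith
  have hcR := (continuousOn_halfTurn a b).mono (Set.prod_mono_left (t := Set.univ) hne)
  have hcR' := (continuousOn_halfTurnDeriv a b).mono (Set.prod_mono_left (t := Set.univ) hne)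
  have hcF' : ContinuousOn
      (fun p : ℝ × Angle d => fderiv ℝ h (halfTurn a b p.1 p.2) (halfTurnDeriv a b p.1 p.2))
      (Metric.closedBall (0 : ℝ) ε ×ˢ Set.univ) :=
    ((hh.continuous_fderiv one_ne_zero).comp_continuousOn hcR).clm_apply hcR'
  obtain ⟨C, hC⟩ := ((isCompact_closedBall (0 : ℝ) ε).prod
    (isCompact_univ (X := Angle d))).exists_bound_of_continuousOn hcF'
  let L (s : ℝ) : Space d ≃ₗᵢ[ℝ] Space d := (Submodule.span ℝ {a + s • b}).reflection
  have hL : ∀ (s : ℝ) (σ : Angle d), halfTurn a b s σ = (rotAngle (L s) σ : Space d) :=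
    fun s σ => halfTurn_eq_reflection a b s σ
  have hcont : Continuous fun σ : Angle d => h σ := hh.continuous.comp continuous_subtype_val
  have h0mem : (0 : ℝ) ∈ Metric.closedBall (0 : ℝ) ε := by simp [hεpos.le]
  have hder := (hasDerivAt_integral_of_dominated_loc_of_deriv_le (μ := surf d) (𝕜 := ℝ)
    (F := fun s (σ : Angle d) => h (halfTurn a b s σ)) (x₀ := (0 : ℝ))
    (F' := fun s (σ : Angle d) => fderiv ℝ h (halfTurn a b s σ) (halfTurnDeriv a b s σ))
    (bound := fun _ => C) (Metric.closedBall_mem_nhds 0 hεpos)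
    (Eventually.of_forall fun s => by
      simp only [hL]
      exact (hcont.comp (continuous_rotAngle _)).aestronglyMeasurable)
    (by
      simp only [hL]
      exact integrable_surf_of_continuous (hcont.comp (continuous_rotAngle _)))
    (by
      have h1 : ContinuousOn (fun σ : Angle d => ((0 : ℝ), σ)) Set.univ := by fun_prop
      have h2 : Set.MapsTo (fun σ : Angle d => ((0 : ℝ), σ)) Set.univ
          (Metric.closedBall (0 : ℝ) ε ×ˢ Set.univ) := fun σ _ => ⟨h0mem, Set.mem_univ _⟩
      have h3 := hcF'.comp h1 h2
      exact (continuousOn_univ.1 h3).aestronglyMeasurable)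
    (Eventually.of_forall fun σ s hs => hC (s, σ) ⟨hs, Set.mem_univ _⟩)
    (integrable_const C)
    (Eventually.of_forall fun σ s hs =>
      ((hh.differentiable one_ne_zero).differentiableAt.hasFDerivAt.comp_hasDerivAt s
        (hasDerivAt_halfTurn a b σ s (hne s hs))))).2
  have hconst : (fun s => ∫ σ : Angle d, h (halfTurn a b s σ) ∂(surf d))
      = fun _ => ∫ σ : Angle d, h σ ∂(surf d) := by
    funext s
    simp only [hL]
    exact integral_rotAngle (L s) hcont
  rw [hconst] at hder
  have hzero := hder.unique (hasDerivAt_const _ _)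
  have hcG : Continuous fun σ : Angle d =>
      fderiv ℝ h σ (inner ℝ a (σ : Space d) • b - inner ℝ b (σ : Space d) • a) := by
    have := hh.continuous_fderiv one_ne_zero
    fun_prop
  rw [← integral_rotAngle (L 0) hcG]
  -- The velocity of the half-turns at s = 0 is twice the skew field evaluated at the image point;
  -- substituting the image point for σ removes the half-turn.
  have hpt : ∀ σ : Angle d,
      fderiv ℝ h (halfTurn a b 0 σ) (halfTurnDeriv a b 0 σ) =
      2 * fderiv ℝ h (rotAngle (L 0) σ) (inner ℝ a (rotAngle (L 0) σ : Space d) • b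
        - inner ℝ b (rotAngle (L 0) σ : Space d) • a) := by
    intro σ
    rw [← hL, ← smul_eq_mul, ← map_smul]
    congr 1
    have haa : inner ℝ a a = (1 : ℝ) := by rw [real_inner_self_eq_norm_sq, ha]; norm_num
    simp only [halfTurn, halfTurnDeriv, zero_smul, add_zero, ha, inner_sub_right,
      inner_smul_right, haa, real_inner_comm a b]
    module
  simp only [hpt, integral_const_mul] at hzero
  linarith

/-- The divergence theorem on the sphere for the tangential field `ν - (ν·σ)σ`. -/
theorem integral_tangential_divergence {d : ℕ} {h : Space d → ℝ} (hh : ContDiff ℝ 1 h)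
    (ν : Space d) :
    ∫ σ : Angle d, (fderiv ℝ h σ (ν - inner ℝ ν (σ : Space d) • (σ : Space d))
      - ((d : ℝ) - 1) * inner ℝ ν (σ : Space d) * h σ) ∂(surf d) = 0 := by
  let e := EuclideanSpace.basisFun (Fin d) ℝ
  have hh' := hh.continuous_fderiv one_ne_zero
  -- The skew identity for the plane of e_i and ν, applied to x_i h(x). In the sum over i, ∑ x_i² =
  -- 1 on the sphere produces the tangential field, and ∑ (ν_i x_i - ν·x) = -(d - 1) ν·x the
  -- zeroth-order term.
  have key : ∀ i, ∫ σ : Angle d, ((inner ℝ (e i) (σ : Space d)) ^ 2 * fderiv ℝ h σ ν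
      - inner ℝ ν (σ : Space d) * fderiv ℝ h σ (inner ℝ (e i) (σ : Space d) • e i)
      + (inner ℝ (e i) ν * inner ℝ (e i) (σ : Space d) - inner ℝ ν (σ : Space d)) * h σ)
        ∂(surf d) = 0 := by
    intro i
    have hg : ContDiff ℝ 1 fun x : Space d => inner ℝ (e i) x * h x :=
      (contDiff_const.inner ℝ contDiff_id).mul hh
    rw [← integral_fderiv_skew hg (e i) ν (by simp)]
    congr 1
    ext σ
    have hd : HasFDerivAt (fun x : Space d => inner ℝ (e i) x * h x)
        ((inner ℝ (e i) (σ : Space d)) • fderiv ℝ h σ + h σ • innerSL ℝ (e i)) (σ : Space d) :=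
      ((innerSL ℝ (e i)).hasFDerivAt).mul
        (hh.differentiable one_ne_zero).differentiableAt.hasFDerivAt
    rw [hd.fderiv]
    have hee : inner ℝ (e i) (e i) = (1 : ℝ) := by simp
    simp only [add_apply, smul_apply, map_sub, map_smul, smul_eq_mul, innerSL_apply_apply, hee]
    ring
  have hsum := Finset.sum_congr rfl fun i (_ : i ∈ Finset.univ) => key i
  rw [← integral_finsetSum _ fun i _ => integrable_surf_of_continuous (by fun_prop),
    Finset.sum_const_zero] at hsum
  rw [← hsum]
  congr 1
  ext σ
  have h1 : ∑ i, inner ℝ (e i) (σ : Space d) ^ 2 = (1 : ℝ) := by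
    have := e.sum_sq_norm_inner_right (σ : Space d)
    simpa using this
  have h2 : ∑ i, inner ℝ (e i) (σ : Space d) • e i = (σ : Space d) := e.sum_repr' _
  have h3 : ∑ i, inner ℝ (e i) ν * inner ℝ (e i) (σ : Space d) = inner ℝ ν (σ : Space d) := by
    have := e.sum_inner_mul_inner ν (σ : Space d)
    simpa [real_inner_comm] using this
  simp only [Finset.sum_add_distrib, Finset.sum_sub_distrib, ← Finset.sum_mul, ← Finset.mul_sum,
    h1, h3, ← map_sum, h2]
  simp
  ring

/-! ### Recursions for the zonal polynomials. -/

/-- The zonal polynomials of the sphere of `ℝᵈ` with value `1` at `1`: classical Legendre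
polynomials for `d = 3`, Chebyshev polynomials for `d = 2`. -/
noncomputable def zonalPoly (d : ℕ) : ℕ → Polynomial ℝ
  | 0 => 1
  | 1 => Polynomial.X
  | n + 2 => Polynomial.C (1 / ((n : ℝ) + d - 1)) *
      (Polynomial.C (2 * (n : ℝ) + d) * Polynomial.X * zonalPoly d (n + 1)
        - Polynomial.C ((n : ℝ) + 1) * zonalPoly d n)

theorem Polynomial.contDiff_eval (p : Polynomial ℝ) (n : WithTop ℕ∞) :
    ContDiff ℝ n fun x => p.eval x := by
  simpa using p.contDiff_aeval (𝕜 := ℝ) n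

theorem zonalPoly_rec {d : ℕ} (hd : 2 ≤ d) (n : ℕ) :
    ((n : Polynomial ℝ) + (d : Polynomial ℝ) - 1) * zonalPoly d (n + 2) =
      (2 * (n : Polynomial ℝ) + (d : Polynomial ℝ)) * Polynomial.X * zonalPoly d (n + 1)
        - ((n : Polynomial ℝ) + 1) * zonalPoly d n := by
  have h2 : (2 : ℝ) ≤ d := by exact_mod_cast hd
  have h : ((n : ℝ) + d - 1) ≠ 0 := by
    have : (0 : ℝ) ≤ n := n.cast_nonneg
    linarith
  have h1 : ((n : Polynomial ℝ) + (d : Polynomial ℝ) - 1) * Polynomial.C (1 / ((n : ℝ) + d - 1)) = 1 := by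
    have : ((n : Polynomial ℝ) + (d : Polynomial ℝ) - 1) = Polynomial.C ((n : ℝ) + d - 1) := by simp
    rw [this, ← Polynomial.C_mul, mul_one_div_cancel h, Polynomial.C_1]
  rw [zonalPoly, ← mul_assoc, h1, one_mul]
  simp only [map_add, map_mul, map_natCast, map_ofNat, map_one]

theorem zonalPoly_eval_rec {d : ℕ} (hd : 2 ≤ d) (n : ℕ) (t : ℝ) :
    ((n : ℝ) + d - 1) * (zonalPoly d (n + 2)).eval t =
      (2 * (n : ℝ) + d) * t * (zonalPoly d (n + 1)).eval t
        - ((n : ℝ) + 1) * (zonalPoly d n).eval t := by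
  simpa using congrArg (Polynomial.eval t) (zonalPoly_rec hd n)

theorem zonalPoly_derivative {d : ℕ} (hd : 2 ≤ d) (n : ℕ) :
    (1 - Polynomial.X ^ 2) * (zonalPoly d (n + 1)).derivative =
      ((n : Polynomial ℝ) + 1) * (zonalPoly d n - Polynomial.X * zonalPoly d (n + 1)) := by
  have h2 : (2 : ℝ) ≤ d := by exact_mod_cast hd
  -- The derivative formulas for two consecutive polynomials have to be carried together:
  -- differentiating the three-term recursion involves both.
  suffices H : (1 - Polynomial.X ^ 2) * (zonalPoly d n).derivative =
      ((n : Polynomial ℝ) + (d : Polynomial ℝ) - 2) * (Polynomial.X * zonalPoly d n - zonalPoly d (n + 1)) ∧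
      (1 - Polynomial.X ^ 2) * (zonalPoly d (n + 1)).derivative =
      ((n : Polynomial ℝ) + 1) * (zonalPoly d n - Polynomial.X * zonalPoly d (n + 1)) from H.2
  induction n with
  | zero => simp [zonalPoly]; ring
  | succ n ih =>
    obtain ⟨hB, hA⟩ := ih
    have hrec := zonalPoly_rec hd n
    refine ⟨?_, ?_⟩
    · rw [hA]
      push_cast
      linear_combination hrec
    · have hne : ((n : Polynomial ℝ) + (d : Polynomial ℝ) - 1) ≠ 0 := by
        have : ((n : Polynomial ℝ) + (d : Polynomial ℝ) - 1) = Polynomial.C ((n : ℝ) + d - 1) := by simp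
        rw [this, Ne, Polynomial.C_eq_zero]
        have : (0 : ℝ) ≤ n := n.cast_nonneg
        linarith
      apply mul_left_cancel₀ hne
      have hder := congrArg Polynomial.derivative hrec
      simp only [Polynomial.derivative_mul, Polynomial.derivative_sub, Polynomial.derivative_add,
        Polynomial.derivative_natCast, Polynomial.derivative_one, Polynomial.derivative_X,
        Polynomial.derivative_ofNat] at hder
      push_cast
      linear_combination (1 - Polynomial.X ^ 2) * hder
        + (2 * (n : Polynomial ℝ) + (d : Polynomial ℝ)) * Polynomial.X * hA
        - ((n : Polynomial ℝ) + 1) * hB + ((n : Polynomial ℝ) + 2) * Polynomial.X * hrec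

theorem zonalPoly_eval_derivative {d : ℕ} (hd : 2 ≤ d) (n : ℕ) (t : ℝ) :
    (1 - t ^ 2) * (zonalPoly d (n + 1)).derivative.eval t =
      ((n : ℝ) + 1) * ((zonalPoly d n).eval t - t * (zonalPoly d (n + 1)).eval t) := by
  simpa using congrArg (Polynomial.eval t) (zonalPoly_derivative hd n)

theorem zonalPoly_natDegree_le (d n : ℕ) : (zonalPoly d n).natDegree ≤ n := by
  induction n using Nat.strong_induction_on with
  | _ n ih =>
    match n with
    | 0 => simp [zonalPoly]
    | 1 => simp [zonalPoly]
    | n + 2 =>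
      have h1 := ih (n + 1) (by omega)
      have h0 := ih n (by omega)
      rw [zonalPoly]
      refine (Polynomial.natDegree_C_mul_le _ _).trans ?_
      refine (Polynomial.natDegree_sub_le _ _).trans (max_le ?_ ?_)
      · rw [mul_assoc]
        refine (Polynomial.natDegree_C_mul_le _ _).trans ?_
        refine Polynomial.natDegree_mul_le.trans ?_
        rw [Polynomial.natDegree_X]
        omega
      · exact (Polynomial.natDegree_C_mul_le _ _).trans (by omega)

theorem zonalPoly_leadingCoeff_rec (d n : ℕ) :
    (zonalPoly d (n + 2)).coeff (n + 2) =
      (2 * (n : ℝ) + d) / ((n : ℝ) + d - 1) * (zonalPoly d (n + 1)).coeff (n + 1) := by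
  have h : (zonalPoly d n).coeff (n + 2) = 0 :=
    Polynomial.coeff_eq_zero_of_natDegree_lt ((zonalPoly_natDegree_le d n).trans_lt (by omega))
  rw [zonalPoly, Polynomial.coeff_C_mul, Polynomial.coeff_sub, Polynomial.coeff_C_mul, h,
    mul_assoc, Polynomial.coeff_C_mul, Polynomial.coeff_X_mul]
  ring

theorem zonalPoly_eval_one {d : ℕ} (hd : 2 ≤ d) (n : ℕ) : (zonalPoly d n).eval 1 = 1 := by
  have h2 : (2 : ℝ) ≤ d := by exact_mod_cast hd
  induction n using Nat.strong_induction_on with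
  | _ n ih =>
    match n with
    | 0 => simp [zonalPoly]
    | 1 => simp [zonalPoly]
    | n + 2 =>
      have h := zonalPoly_eval_rec hd n 1
      rw [ih (n + 1) (by omega), ih n (by omega)] at h
      have : (0 : ℝ) ≤ n := n.cast_nonneg
      have hne : ((n : ℝ) + d - 1) ≠ 0 := by linarith
      apply mul_left_cancel₀ hne
      linarith

/-! ### The divergence identity for products of zonal polynomials. -/

theorem continuous_dotp_right {d : ℕ} (μ : Angle d) : Continuous fun σ : Angle d => dotp μ σ := by
  unfold dotp
  fun_prop

theorem continuous_dotp_left {d : ℕ} (μ : Angle d) : Continuous fun σ : Angle d => dotp σ μ := by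
  unfold dotp
  fun_prop

theorem continuous_dotp {d : ℕ} : Continuous fun p : Angle d × Angle d => dotp p.1 p.2 := by
  unfold dotp
  fun_prop

theorem dotp_comm {d : ℕ} (μ ν : Angle d) : dotp μ ν = dotp ν μ := real_inner_comm _ _

theorem dotp_self {d : ℕ} (μ : Angle d) : dotp μ μ = 1 := by
  rw [dotp, real_inner_self_eq_norm_sq, norm_eq_of_mem_sphere]
  norm_num

theorem dotp_mem_Icc {d : ℕ} (μ ν : Angle d) : dotp μ ν ∈ Set.Icc (-1 : ℝ) 1 := by
  have := abs_real_inner_le_norm (μ : Space d) (ν : Space d)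
  rw [norm_eq_of_mem_sphere, norm_eq_of_mem_sphere, one_mul] at this
  exact abs_le.1 this

attribute [fun_prop] continuous_dotp_right continuous_dotp_left

theorem integrable_poly_dotp_mul {d : ℕ} (p q : Polynomial ℝ) (μ ν : Angle d) :
    Integrable (fun σ => p.eval (dotp μ σ) * q.eval (dotp ν σ)) (surf d) :=
  integrable_surf_of_continuous
    ((p.continuous.comp (continuous_dotp_right μ)).mul (q.continuous.comp (continuous_dotp_right ν)))

/-- The divergence theorem with pole ν for x ↦ p(μ·x) q(ν·x). Choosing p a power and q a zonal
polynomial gives every recursion used below. -/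
theorem integral_poly_divergence {d : ℕ} (p q : Polynomial ℝ) (μ ν : Angle d) :
    ∫ σ, (p.derivative.eval (dotp μ σ) * (dotp μ ν - dotp μ σ * dotp ν σ) * q.eval (dotp ν σ)
      + p.eval (dotp μ σ) * ((1 - dotp ν σ ^ 2) * q.derivative.eval (dotp ν σ)
        - ((d : ℝ) - 1) * dotp ν σ * q.eval (dotp ν σ))) ∂(surf d) = 0 := by
  let h : Space d → ℝ := fun x => p.eval (inner ℝ (μ : Space d) x) * q.eval (inner ℝ (ν : Space d) x)
  have hh : ContDiff ℝ 1 h := by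
    have (r : Polynomial ℝ) (a : Space d) : ContDiff ℝ 1 fun x => r.eval (inner ℝ a x) := by
      have := (r.contDiff_eval 1).comp (contDiff_const.inner ℝ contDiff_id :
        ContDiff ℝ 1 fun x : Space d => inner ℝ a x)
      exact this
    exact (this p μ).mul (this q ν)
  rw [← integral_tangential_divergence hh (ν : Space d)]
  congr 1
  ext σ
  have (r : Polynomial ℝ) (a : Space d) : HasFDerivAt (fun x => r.eval (inner ℝ a x))
      (r.derivative.eval (inner ℝ a (σ : Space d)) • innerSL ℝ a) (σ : Space d) :=
    (r.hasDerivAt _).comp_hasFDerivAt (σ : Space d) (innerSL ℝ a).hasFDerivAt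
  have hd := (this p μ).mul (this q ν)
  have hνν : inner ℝ (ν : Space d) (ν : Space d) = (1 : ℝ) := dotp_self ν
  rw [show fderiv ℝ h σ = _ from hd.fderiv]
  simp only [add_apply, smul_apply, map_sub, map_smul, smul_eq_mul, innerSL_apply_apply, hνν, dotp,
    h]
  ring

/-! ### The Funk–Hecke formula for polynomial kernels. -/

/-- The moments `∫ (μ·σ)ᵃ dσ`. -/
noncomputable def zonalMoment (d : ℕ) : ℕ → ℝ
  | 0 => (surf d).real Set.univ
  | 1 => 0
  | a + 2 => ((a : ℝ) + 1) / (a + d) * zonalMoment d a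

theorem integral_dotp_pow {d : ℕ} (hd : 2 ≤ d) (a : ℕ) (μ : Angle d) :
    ∫ σ, dotp μ σ ^ a ∂(surf d) = zonalMoment d a := by
  have h2 : (2 : ℝ) ≤ d := by exact_mod_cast hd
  have hint (n : ℕ) : Integrable (fun σ => dotp μ σ ^ n) (surf d) :=
    integrable_surf_of_continuous (by fun_prop)
  induction a using Nat.strong_induction_on with
  | _ a ih =>
    match a with
    | 0 => simp [zonalMoment]
    | 1 =>
      have h := integral_poly_divergence 1 1 μ μ
      simp only [Polynomial.derivative_one, Polynomial.eval_zero, Polynomial.eval_one, zero_mul,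
        one_mul, mul_zero, zero_add, zero_sub, mul_one, integral_neg, integral_const_mul] at h
      have hne : (d : ℝ) - 1 ≠ 0 := by linarith
      simpa [zonalMoment, hne] using h
    | a + 2 =>
      have h := integral_poly_divergence 1 (Polynomial.X ^ (a + 1)) μ μ
      replace h := (h.symm.trans (integral_congr_ae (g := fun σ => (a + 1 : ℝ) * dotp μ σ ^ a - (a + d : ℝ) * dotp μ σ ^ (a + 2))
        (Eventually.of_forall fun σ => by
          simp only [Polynomial.derivative_one, Polynomial.eval_zero, Polynomial.eval_one,
            Polynomial.derivative_X_pow, Polynomial.eval_mul, Polynomial.eval_pow,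
            Polynomial.eval_X, Polynomial.eval_C, Nat.add_sub_cancel]
          push_cast
          ring))).symm
      rw [integral_sub ((hint _).const_mul _)
        ((hint _).const_mul _), integral_const_mul, integral_const_mul, ih a (by omega)] at h
      have : (0 : ℝ) ≤ a := a.cast_nonneg
      have hne : (a : ℝ) + d ≠ 0 := by linarith
      rw [zonalMoment]
      field_simp
      linarith

/-- The factor with `∫ (μ·σ)ᵃ Q(σ·ν) dσ = fhCoeff d ℓ a * Q(μ·ν)` for `Q = zonalPoly d ℓ`. -/
noncomputable def fhCoeff (d : ℕ) : ℕ → ℕ → ℝ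
  | 0, a => zonalMoment d a
  | _ + 1, 0 => 0
  | ℓ + 1, a + 1 => ((a : ℝ) + 1) / (a + ℓ + d) * fhCoeff d ℓ a

theorem fhCoeff_eq_zero (d : ℕ) {ℓ a : ℕ} (h : a < ℓ) : fhCoeff d ℓ a = 0 := by
  induction ℓ generalizing a with
  | zero => omega
  | succ ℓ ih =>
    cases a with
    | zero => rw [fhCoeff]
    | succ a => rw [fhCoeff, ih (by omega), mul_zero]

/-- The inductive step of the Funk–Hecke formula produces two coefficients, for (ℓ + 1, a) and (ℓ, a
+ 1). This relation makes the two terms combine into the three-term recursion. -/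
theorem fhCoeff_shift {d : ℕ} (hd : 2 ≤ d) (ℓ a : ℕ) :
    ((a : ℝ) + 1) * fhCoeff d (ℓ + 1) a = ((a : ℝ) + 1 - ℓ) * fhCoeff d ℓ (a + 1) := by
  have h2 : (2 : ℝ) ≤ d := by exact_mod_cast hd
  induction ℓ generalizing a with
  | zero =>
    cases a with
    | zero => simp [fhCoeff, zonalMoment]
    | succ a => simp [fhCoeff, zonalMoment]
  | succ ℓ ih =>
    cases a with
    | zero =>
      rw [fhCoeff]
      cases ℓ with
      | zero => simp
      | succ ℓ => rw [fhCoeff_eq_zero d (show 0 + 1 < ℓ + 1 + 1 by omega)]; simp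
    | succ a =>
      rw [fhCoeff, fhCoeff]
      have ih' := ih a
      have ha : (0 : ℝ) ≤ a := a.cast_nonneg
      have hl : (0 : ℝ) ≤ ℓ := ℓ.cast_nonneg
      have h1 : (a : ℝ) + (ℓ + 1) + d ≠ 0 := by linarith
      have h3 : (a : ℝ) + 1 + ℓ + d ≠ 0 := by linarith
      push_cast
      field_simp
      rw [show (a : ℝ) + (ℓ + 1) + d = a + 1 + ℓ + d by ring]
      field_simp
      linear_combination ih'

/-- The Funk–Hecke formula for monomials. -/
theorem integral_dotp_pow_mul_zonalPoly {d : ℕ} (hd : 2 ≤ d) (ℓ a : ℕ) (μ ν : Angle d) :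
    ∫ σ, dotp μ σ ^ a * (zonalPoly d ℓ).eval (dotp ν σ) ∂(surf d)
      = fhCoeff d ℓ a * (zonalPoly d ℓ).eval (dotp μ ν) := by
  have h2 : (2 : ℝ) ≤ d := by exact_mod_cast hd
  have hint (n k : ℕ) : Integrable
      (fun σ => dotp μ σ ^ n * (zonalPoly d k).eval (dotp ν σ)) (surf d) := by
    simpa using integrable_poly_dotp_mul (Polynomial.X ^ n) (zonalPoly d k) μ ν
  induction ℓ using Nat.strong_induction_on generalizing a with
  | _ ℓ ih =>
    match ℓ with
    | 0 => simp [zonalPoly, fhCoeff, integral_dotp_pow hd]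
    | 1 =>
      have h := integral_poly_divergence (Polynomial.X ^ a) 1 μ ν
      cases a with
      | zero =>
        have := integral_dotp_pow hd 1 ν
        simpa [zonalPoly, fhCoeff, zonalMoment] using this
      | succ a =>
        replace h := (h.symm.trans (integral_congr_ae (g := fun σ => ((a + 1 : ℝ) * dotp μ ν) *
              (dotp μ σ ^ a * (zonalPoly d 0).eval (dotp ν σ))
            - (a + d : ℝ) * (dotp μ σ ^ (a + 1) * (zonalPoly d 1).eval (dotp ν σ)))
          (Eventually.of_forall fun σ => by
            simp only [Polynomial.derivative_one, Polynomial.eval_zero, Polynomial.eval_one,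
              Polynomial.derivative_X_pow, Polynomial.eval_mul, Polynomial.eval_pow,
              Polynomial.eval_X, Polynomial.eval_C, Nat.add_sub_cancel, zonalPoly]
            push_cast
            ring))).symm
        rw [integral_sub ((hint _ _).const_mul _)
          ((hint _ _).const_mul _), integral_const_mul, integral_const_mul, ih 0 (by omega)] at h
        have ha : (0 : ℝ) ≤ a := a.cast_nonneg
        have hne : (a : ℝ) + d ≠ 0 := by linarith
        rw [fhCoeff]
        simp only [zonalPoly, Polynomial.eval_one, Polynomial.eval_X, Nat.cast_zero, add_zero]
          at h ⊢
        field_simp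
        linear_combination -h
    | ℓ + 2 =>
      have hl : (0 : ℝ) ≤ ℓ := ℓ.cast_nonneg
      have ha : (0 : ℝ) ≤ a := a.cast_nonneg
      have h := integral_poly_divergence (Polynomial.X ^ a) (zonalPoly d (ℓ + 1)) μ ν
      have hrec := zonalPoly_eval_rec hd ℓ
      have hder := zonalPoly_eval_derivative hd ℓ
      -- The factor 2ℓ + d lets t P_{ℓ+1}(t) be replaced, by the recursion, with a combination of
      -- P_{ℓ+2} and P_ℓ; the latter is covered by the induction hypothesis.
      have h0 := congrArg (fun x => (2 * (ℓ : ℝ) + d) * x) h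
      simp only [mul_zero] at h0
      rw [← integral_const_mul] at h0
      cases a with
      | zero =>
        replace h0 := (h0.symm.trans (integral_congr_ae (g := fun σ => ((ℓ + 1 : ℝ) * ℓ) * (dotp μ σ ^ 0 * (zonalPoly d ℓ).eval (dotp ν σ))
            - ((ℓ + d : ℝ) * (ℓ + d - 1)) *
              (dotp μ σ ^ 0 * (zonalPoly d (ℓ + 2)).eval (dotp ν σ)))
          (Eventually.of_forall fun σ => by
            simp only [Polynomial.derivative_one, Polynomial.eval_zero, Polynomial.eval_one,
              pow_zero, hder]
            linear_combination ((ℓ : ℝ) + d) * hrec (dotp ν σ)))).symm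
        rw [integral_sub ((hint _ _).const_mul _)
          ((hint _ _).const_mul _), integral_const_mul, integral_const_mul, ih ℓ (by omega)] at h0
        -- The remaining lower term is ℓ ∫ P_ℓ: the factor vanishes for ℓ = 0 and the integral for ℓ
        -- > 0.
        have hz : (ℓ : ℝ) * fhCoeff d ℓ 0 = 0 := by
          cases ℓ with
          | zero => simp
          | succ ℓ => rw [fhCoeff, mul_zero]
        have hne : ((ℓ + d : ℝ) * (ℓ + d - 1)) ≠ 0 := by
          apply mul_ne_zero <;> linarith
        rw [fhCoeff, zero_mul]
        apply mul_left_cancel₀ hne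
        linear_combination (ℓ + 1 : ℝ) * (zonalPoly d ℓ).eval (dotp μ ν) * hz - h0
      | succ a =>
        replace h0 := (h0.symm.trans (integral_congr_ae (g := fun σ => ((2 * ℓ + d : ℝ) * (a + 1) * dotp μ ν) *
              (dotp μ σ ^ a * (zonalPoly d (ℓ + 1)).eval (dotp ν σ))
            + ((ℓ + 1 : ℝ) * (ℓ - a - 1)) *
              (dotp μ σ ^ (a + 1) * (zonalPoly d ℓ).eval (dotp ν σ))
            - ((a + ℓ + 1 + d : ℝ) * (ℓ + d - 1)) *
              (dotp μ σ ^ (a + 1) * (zonalPoly d (ℓ + 2)).eval (dotp ν σ)))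
          (Eventually.of_forall fun σ => by
            simp only [Polynomial.derivative_X_pow, Polynomial.eval_mul, Polynomial.eval_pow,
              Polynomial.eval_X, Polynomial.eval_C, Nat.add_sub_cancel, hder]
            push_cast
            linear_combination ((a : ℝ) + ℓ + 1 + d) * dotp μ σ ^ (a + 1) * hrec (dotp ν σ)))).symm
        rw [integral_sub
          (by exact ((hint _ _).const_mul _).add ((hint _ _).const_mul _)) ((hint _ _).const_mul _),
          integral_add ((hint _ _).const_mul _) ((hint _ _).const_mul _),
          integral_const_mul, integral_const_mul, integral_const_mul, ih ℓ (by omega),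
          ih (ℓ + 1) (by omega)] at h0
        have hsh := fhCoeff_shift hd ℓ a
        push_cast at ha
        have hne1 : (a + (ℓ + 1) + d : ℝ) ≠ 0 := by linarith
        have hne : ((ℓ + d - 1 : ℝ)) ≠ 0 := by linarith
        rw [fhCoeff]
        push_cast
        field_simp
        apply mul_left_cancel₀ hne
        linear_combination -h0 + (ℓ + 1 : ℝ) * (zonalPoly d ℓ).eval (dotp μ ν) * hsh
          - (a + 1 : ℝ) * fhCoeff d (ℓ + 1) a * hrec (dotp μ ν)

/-- The Funk–Hecke formula for polynomials. -/
theorem integral_poly_mul_zonalPoly {d : ℕ} (hd : 2 ≤ d) (p : Polynomial ℝ) (ℓ : ℕ)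
    (μ ν : Angle d) :
    ∫ σ, p.eval (dotp μ σ) * (zonalPoly d ℓ).eval (dotp ν σ) ∂(surf d)
      = (∑ a ∈ Finset.range (p.natDegree + 1), p.coeff a * fhCoeff d ℓ a) *
        (zonalPoly d ℓ).eval (dotp μ ν) := by
  have hint (n : ℕ) : Integrable
      (fun σ => dotp μ σ ^ n * (zonalPoly d ℓ).eval (dotp ν σ)) (surf d) := by
    simpa using integrable_poly_dotp_mul (Polynomial.X ^ n) (zonalPoly d ℓ) μ ν
  simp only [Polynomial.eval_eq_sum_range (p := p), Finset.sum_mul, mul_assoc]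
  rw [integral_finsetSum _ fun a _ => (hint a).const_mul _]
  refine Finset.sum_congr rfl fun a _ => ?_
  rw [integral_const_mul, integral_dotp_pow_mul_zonalPoly hd]

/-! ### Orthogonality and normalisation. -/

/-- The square norm of `zonalPoly d ℓ` on the sphere. -/
noncomputable def zonalNorm (d ℓ : ℕ) : ℝ := (zonalPoly d ℓ).coeff ℓ * fhCoeff d ℓ ℓ

/-- The Funk–Hecke factor of a power below ℓ is zero, and P_k contains only such powers. For k = ℓ
the same reasoning leaves the top power alone, which is the reason for the form of `zonalNorm`. -/
theorem integral_zonalPoly_mul_zonalPoly_of_lt {d : ℕ} (hd : 2 ≤ d) {k ℓ : ℕ} (h : k < ℓ)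
    (μ ν : Angle d) :
    ∫ σ, (zonalPoly d k).eval (dotp μ σ) * (zonalPoly d ℓ).eval (dotp ν σ) ∂(surf d) = 0 := by
  rw [integral_poly_mul_zonalPoly hd, Finset.sum_eq_zero, zero_mul]
  intro a ha
  have := zonalPoly_natDegree_le d k
  rw [fhCoeff_eq_zero d (by rw [Finset.mem_range] at ha; omega), mul_zero]

theorem integral_zonalPoly_mul_zonalPoly_of_ne {d : ℕ} (hd : 2 ≤ d) {k ℓ : ℕ} (h : k ≠ ℓ)
    (μ ν : Angle d) :
    ∫ σ, (zonalPoly d k).eval (dotp μ σ) * (zonalPoly d ℓ).eval (dotp ν σ) ∂(surf d) = 0 := by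
  rcases h.lt_or_gt with h | h
  · exact integral_zonalPoly_mul_zonalPoly_of_lt hd h μ ν
  · simpa only [mul_comm] using integral_zonalPoly_mul_zonalPoly_of_lt hd h ν μ

theorem integral_zonalPoly_mul_zonalPoly_self {d : ℕ} (hd : 2 ≤ d) (ℓ : ℕ) (μ ν : Angle d) :
    ∫ σ, (zonalPoly d ℓ).eval (dotp μ σ) * (zonalPoly d ℓ).eval (dotp ν σ) ∂(surf d)
      = zonalNorm d ℓ * (zonalPoly d ℓ).eval (dotp μ ν) := by
  rw [integral_poly_mul_zonalPoly hd]
  congr 1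
  have hdeg := zonalPoly_natDegree_le d ℓ
  rw [zonalNorm]
  rcases hdeg.lt_or_eq with h | h
  · rw [Polynomial.coeff_eq_zero_of_natDegree_lt h, zero_mul]
    refine Finset.sum_eq_zero fun a ha => ?_
    rw [fhCoeff_eq_zero d (by rw [Finset.mem_range] at ha; omega), mul_zero]
  · rw [Finset.sum_eq_single ℓ]
    · intro a ha hne
      rw [fhCoeff_eq_zero d (by rw [Finset.mem_range] at ha; omega), mul_zero]
    · intro h'
      exact absurd (Finset.mem_range.2 (by omega)) h'

/-- The ratio of leading coefficients times the ratio of top Funk–Hecke factors. It gives the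
constant π in the plane for ℓ ≥ 1 and 4π/(2ℓ + 1) in space, the inverses of the constants in
`normLegendre`. -/
theorem zonalNorm_rec {d : ℕ} (hd : 2 ≤ d) (n : ℕ) :
    zonalNorm d (n + 2) = (2 * n + d) * (n + 2) / ((n + d - 1) * (2 * n + 2 + d)) *
      zonalNorm d (n + 1) := by
  have h2 : (2 : ℝ) ≤ d := by exact_mod_cast hd
  have hn : (0 : ℝ) ≤ n := n.cast_nonneg
  have h1 : (n : ℝ) + d - 1 ≠ 0 := by linarith
  have h3 : (2 * n + 2 + d : ℝ) ≠ 0 := by linarith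
  have h4 : ((n : ℝ) + 1 + (n + 1) + d) ≠ 0 := by linarith
  rw [zonalNorm, zonalNorm, zonalPoly_leadingCoeff_rec, fhCoeff]
  push_cast
  rw [show ((n : ℝ) + 1 + (n + 1) + d) = 2 * n + 2 + d by ring]
  field_simp
  ring

theorem zonalNorm_zero (d : ℕ) : zonalNorm d 0 = (surf d).real Set.univ := by
  simp [zonalNorm, zonalPoly, fhCoeff, zonalMoment]

theorem zonalNorm_one (d : ℕ) : zonalNorm d 1 = (surf d).real Set.univ / d := by
  simp [zonalNorm, zonalPoly, fhCoeff, zonalMoment, div_eq_inv_mul]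

theorem surf_real_univ_two : (surf 2).real Set.univ = 2 * Real.pi := by
  rw [Measure.real, surf, Measure.toSphere_apply_univ, EuclideanSpace.volume_ball_fin_two]
  simp [Real.pi_pos.le]

theorem surf_real_univ_three : (surf 3).real Set.univ = 4 * Real.pi := by
  rw [Measure.real, surf, Measure.toSphere_apply_univ, EuclideanSpace.volume_ball_fin_three]
  have : (0 : ℝ) ≤ Real.pi * 4 / 3 := by positivity
  simp [this]
  ring

theorem zonalNorm_two (n : ℕ) : zonalNorm 2 (n + 1) = Real.pi := by
  induction n with
  | zero => rw [zonalNorm_one, surf_real_univ_two]; push_cast; ring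
  | succ n ih =>
    rw [zonalNorm_rec le_rfl, ih]
    push_cast
    have h1 : (n : ℝ) + 2 - 1 = n + 1 := by ring
    rw [h1]
    have : (n : ℝ) + 1 ≠ 0 := by positivity
    field_simp
    ring

theorem zonalNorm_three (n : ℕ) : zonalNorm 3 n = 4 * Real.pi / (2 * n + 1) := by
  cases n with
  | zero => rw [zonalNorm_zero, surf_real_univ_three]; simp
  | succ n =>
    induction n with
    | zero => rw [zonalNorm_one, surf_real_univ_three]; push_cast; ring
    | succ n ih =>
      rw [zonalNorm_rec (by norm_num), ih]
      push_cast
      have h1 : (n : ℝ) + 3 - 1 = n + 2 := by ring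
      rw [h1]
      field_simp
      ring

theorem zonalPoly_two (n : ℕ) : zonalPoly 2 n = Polynomial.Chebyshev.T ℝ (n : ℤ) := by
  induction n using Nat.strong_induction_on with
  | _ n ih =>
    match n with
    | 0 => simp [zonalPoly]
    | 1 => simp [zonalPoly]
    | n + 2 =>
      have h := zonalPoly_rec le_rfl n
      rw [ih n (by omega), ih (n + 1) (by omega)] at h
      have hne : ((n : Polynomial ℝ) + 1) ≠ 0 := by exact_mod_cast n.succ_ne_zero
      push_cast at h ⊢
      rw [Polynomial.Chebyshev.T_add_two]
      apply mul_left_cancel₀ hne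
      linear_combination h

theorem zonalPoly_three (n : ℕ) : zonalPoly 3 n = legendrePoly n := by
  induction n using Nat.strong_induction_on with
  | _ n ih =>
    match n with
    | 0 => simp [zonalPoly, legendrePoly]
    | 1 => simp [zonalPoly, legendrePoly]
    | n + 2 =>
      rw [zonalPoly, legendrePoly, ih n (by omega), ih (n + 1) (by omega)]
      push_cast
      rw [show (n : ℝ) + 3 - 1 = n + 2 by ring]

theorem zonalNorm_pos {d : ℕ} (hd : d = 2 ∨ d = 3) (ℓ : ℕ) : 0 < zonalNorm d ℓ := by
  have := Real.pi_pos
  rcases hd with rfl | rfl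
  · cases ℓ with
    | zero => rw [zonalNorm_zero, surf_real_univ_two]; positivity
    | succ n => rw [zonalNorm_two]; positivity
  · rw [zonalNorm_three]; positivity

theorem normLegendre_eq {d : ℕ} (hd : d = 2 ∨ d = 3) (ℓ : ℕ) (t : ℝ) :
    normLegendre d ℓ t = (zonalNorm d ℓ)⁻¹ * (zonalPoly d ℓ).eval t := by
  rcases hd with rfl | rfl
  · rw [normLegendre, if_pos rfl, zonalPoly_two]
    cases ℓ with
    | zero => simp [zonalNorm_zero, surf_real_univ_two]
    | succ n => simp [zonalNorm_two]
  · rw [normLegendre, if_neg (by norm_num), zonalPoly_three, zonalNorm_three, inv_div]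

theorem normLegendre_one_pos {d : ℕ} (hd : d = 2 ∨ d = 3) (ℓ : ℕ) : 0 < normLegendre d ℓ 1 := by
  rw [normLegendre_eq hd, zonalPoly_eval_one (by omega), mul_one]
  exact inv_pos.2 (zonalNorm_pos hd ℓ)

theorem contDiff_normLegendre {d : ℕ} (hd : d = 2 ∨ d = 3) (ℓ : ℕ) {n : WithTop ℕ∞} :
    ContDiff ℝ n (normLegendre d ℓ) := by
  rw [show normLegendre d ℓ = _ from funext (normLegendre_eq hd ℓ)]
  exact contDiff_const.mul ((zonalPoly d ℓ).contDiff_eval n)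

theorem continuous_normLegendre {d : ℕ} (hd : d = 2 ∨ d = 3) (ℓ : ℕ) :
    Continuous (normLegendre d ℓ) :=
  (contDiff_normLegendre hd ℓ (n := 0)).continuous

/-- The normalised Legendre polynomials are the kernels of mutually orthogonal projections. -/
theorem integral_normLegendre_mul {d : ℕ} (hd : d = 2 ∨ d = 3) (k ℓ : ℕ) (μ ν : Angle d) :
    ∫ σ, normLegendre d k (dotp μ σ) * normLegendre d ℓ (dotp ν σ) ∂(surf d)
      = if k = ℓ then normLegendre d ℓ (dotp μ ν) else 0 := by
  have h2 : 2 ≤ d := by omega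
  simp only [normLegendre_eq hd]
  have : ∀ σ : Angle d, (zonalNorm d k)⁻¹ * (zonalPoly d k).eval (dotp μ σ) *
      ((zonalNorm d ℓ)⁻¹ * (zonalPoly d ℓ).eval (dotp ν σ)) =
      ((zonalNorm d k)⁻¹ * (zonalNorm d ℓ)⁻¹) *
        ((zonalPoly d k).eval (dotp μ σ) * (zonalPoly d ℓ).eval (dotp ν σ)) := fun σ => by ring
  simp only [this, integral_const_mul]
  split_ifs with h
  · subst h
    have := (zonalNorm_pos hd k).ne'
    rw [integral_zonalPoly_mul_zonalPoly_self h2]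
    field_simp
  · rw [integral_zonalPoly_mul_zonalPoly_of_ne h2 h, mul_zero]

/-! ### Density of the spherical harmonics. -/

/-- The zonal function `P_ℓ(ν·σ)` with pole `ν`. -/
noncomputable def zonal {d : ℕ} (hd : d = 2 ∨ d = 3) (ℓ : ℕ) (ν : Angle d) : C(Angle d, ℝ) :=
  ⟨fun σ => normLegendre d ℓ (dotp ν σ),
    (continuous_normLegendre hd ℓ).comp (continuous_dotp_right ν)⟩

/-- The span of the zonal functions of degree `ℓ`: the spherical harmonics of degree `ℓ`. -/
noncomputable def harmonics {d : ℕ} (hd : d = 2 ∨ d = 3) (ℓ : ℕ) : Submodule ℝ C(Angle d, ℝ) :=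
  Submodule.span ℝ (Set.range (zonal hd ℓ))

/-- By the three-term recursion, t P_{ℓ+1}(t) is a combination of P_{ℓ+2} and P_ℓ, so multiplication
by ν·σ preserves the span of the zonal functions with pole ν. -/
theorem dotp_pow_mul_zonalPoly_mem {d : ℕ} (hd : d = 2 ∨ d = 3) (ν : Angle d) (n ℓ : ℕ)
    (g : C(Angle d, ℝ)) (hg : ∀ σ, g σ = dotp ν σ ^ n * (zonalPoly d ℓ).eval (dotp ν σ)) :
    g ∈ ⨆ k, harmonics hd k := by
  induction n generalizing ℓ g with
  | zero =>
    have : g = zonalNorm d ℓ • zonal hd ℓ ν := by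
      ext σ
      have := (zonalNorm_pos hd ℓ).ne'
      simp [hg, zonal, normLegendre_eq hd]
      field_simp
    rw [this]
    exact Submodule.mem_iSup_of_mem ℓ
      (Submodule.smul_mem _ _ (Submodule.subset_span (Set.mem_range_self ν)))
  | succ n ih =>
    let G (k : ℕ) : C(Angle d, ℝ) := ⟨fun σ => dotp ν σ ^ n * (zonalPoly d k).eval (dotp ν σ),
      ((continuous_dotp_right ν).pow n).mul
        ((zonalPoly d k).continuous.comp (continuous_dotp_right ν))⟩
    have hG (k : ℕ) : G k ∈ ⨆ k, harmonics hd k := ih k (G k) fun σ => rfl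
    cases ℓ with
    | zero =>
      have : g = G 1 := by
        ext σ
        simp [hg, G, zonalPoly]
        ring
      rw [this]
      exact hG 1
    | succ ℓ =>
      have h2 : 2 ≤ d := by omega
      have hne : (2 * ℓ + d : ℝ) ≠ 0 := by positivity
      have : g = (((ℓ : ℝ) + d - 1) / (2 * ℓ + d)) • G (ℓ + 2)
          + (((ℓ : ℝ) + 1) / (2 * ℓ + d)) • G ℓ := by
        ext σ
        have hrec := zonalPoly_eval_rec h2 ℓ (dotp ν σ)
        simp only [hg, G, ContinuousMap.add_apply, ContinuousMap.smul_apply, smul_eq_mul,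
          ContinuousMap.coe_mk]
        field_simp
        linear_combination -dotp ν σ ^ n * hrec
      rw [this]
      exact Submodule.add_mem _ (Submodule.smul_mem _ _ (hG _)) (Submodule.smul_mem _ _ (hG _))

/-- The restriction of the linear form `⟨y, ·⟩` to the sphere. -/
noncomputable def linForm {d : ℕ} (y : Space d) : C(Angle d, ℝ) :=
  ⟨fun σ => inner ℝ y (σ : Space d), by fun_prop⟩

theorem linForm_pow_mem {d : ℕ} (hd : d = 2 ∨ d = 3) (y : Space d) (n : ℕ) :
    linForm y ^ n ∈ ⨆ k, harmonics hd k := by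
  have : Nontrivial (Space d) := by
    have : Nonempty (Fin d) := ⟨⟨0, by omega⟩⟩
    infer_instance
  obtain ⟨ν, hν⟩ : ∃ ν : Angle d, y = ‖y‖ • (ν : Space d) := by
    by_cases hy : y = 0
    · obtain ⟨z, hz⟩ := exists_norm_eq (Space d) zero_le_one
      exact ⟨⟨z, by simpa using hz⟩, by simp [hy]⟩
    · refine ⟨⟨(‖y‖)⁻¹ • y, by simp [norm_smul, hy]⟩, ?_⟩
      have : ‖y‖ ≠ 0 := norm_ne_zero_iff.2 hy
      simp [smul_smul, this]
  let g : C(Angle d, ℝ) := ⟨fun σ => dotp ν σ ^ n, by fun_prop⟩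
  have : linForm y ^ n = ‖y‖ ^ n • g := by
    ext σ
    simp only [linForm, ContinuousMap.pow_apply, ContinuousMap.coe_mk, ContinuousMap.smul_apply,
      smul_eq_mul, g, dotp]
    conv_lhs => rw [hν, real_inner_smul_left, mul_pow]
  rw [this]
  exact Submodule.smul_mem _ _ (dotp_pow_mul_zonalPoly_mem hd ν n 0 g fun σ => by
    simp [g, zonalPoly])

/-- The power series involves only powers of a single linear form, each a polynomial in ν·σ for one
pole ν. Exponentials are chosen because their products are again exponentials, which spares an
analysis of products of zonal functions with different poles. -/
theorem exp_linForm_mem {d : ℕ} (hd : d = 2 ∨ d = 3) (y : Space d) :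
    NormedSpace.exp (linForm y) ∈ (⨆ k, harmonics hd k).topologicalClosure := by
  have h := NormedSpace.exp_series_hasSum_exp' (𝕂 := ℝ) (linForm y)
  refine (Submodule.isClosed_topologicalClosure _).mem_of_tendsto h (Eventually.of_forall fun s => ?_)
  exact Submodule.le_topologicalClosure _
    (Submodule.sum_mem _ fun n _ => Submodule.smul_mem _ _ (linForm_pow_mem hd y n))

theorem exp_linForm_apply {d : ℕ} (y : Space d) (σ : Angle d) :
    NormedSpace.exp (linForm y) σ = Real.exp (inner ℝ y (σ : Space d)) := by
  have h := NormedSpace.map_exp (ContinuousMap.evalAlgHom ℝ ℝ σ : C(Angle d, ℝ) →ₐ[ℝ] ℝ)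
    (continuous_eval_const σ) (linForm y)
  rw [Real.exp_eq_exp_ℝ]
  exact h

/-- The exponentials `σ ↦ exp ⟨y, σ⟩` as a monoid homomorphism in `y`. -/
noncomputable def expLinForm (d : ℕ) : Multiplicative (Space d) →* C(Angle d, ℝ) where
  toFun y := NormedSpace.exp (linForm y.toAdd)
  map_one' := by
    ext σ
    simp [exp_linForm_apply]
  map_mul' y z := by
    ext σ
    simp [exp_linForm_apply, inner_add_left, Real.exp_add]

/-- Spherical harmonics are uniformly dense in the continuous functions. -/
theorem iSup_harmonics_topologicalClosure {d : ℕ} (hd : d = 2 ∨ d = 3) :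
    (⨆ k, harmonics hd k).topologicalClosure = ⊤ := by
  let A : Subalgebra ℝ C(Angle d, ℝ) := Algebra.adjoin ℝ (Set.range (expLinForm d))
  have hsep : A.SeparatesPoints := by
    intro σ τ hne
    refine ⟨_, ⟨expLinForm d (Multiplicative.ofAdd (σ : Space d)),
      Algebra.subset_adjoin (Set.mem_range_self _), rfl⟩, ?_⟩
    change NormedSpace.exp (linForm (σ : Space d)) σ ≠ NormedSpace.exp (linForm (σ : Space d)) τ
    rw [exp_linForm_apply, exp_linForm_apply]
    intro h
    have h1 := Real.exp_injective h
    have h2 : inner ℝ (σ : Space d) (σ : Space d) = (1 : ℝ) := dotp_self σ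
    rw [h2] at h1
    exact hne (Subtype.ext ((inner_eq_one_iff_of_norm_eq_one (𝕜 := ℝ) (by simp) (by simp)).1
      h1.symm))
  have htop := ContinuousMap.subalgebra_topologicalClosure_eq_top_of_separatesPoints A hsep
  have hle : A.toSubmodule ≤ (⨆ k, harmonics hd k).topologicalClosure := by
    -- The exponentials form a multiplicative monoid, so the algebra they generate is their linear
    -- span.
    rw [Algebra.adjoin_eq_span, ← MonoidHom.coe_mrange, Submonoid.closure_eq, Submodule.span_le]
    rintro _ ⟨y, rfl⟩
    exact exp_linForm_mem hd y.toAdd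
  rw [eq_top_iff]
  intro f _
  have hf : f ∈ A.topologicalClosure := by rw [htop]; trivial
  have hf' : f ∈ closure (A.toSubmodule : Set C(Angle d, ℝ)) := hf
  exact closure_minimal hle (Submodule.isClosed_topologicalClosure _) hf'

theorem exists_harmonics_eLpNorm_sub_le {d : ℕ} (hd : d = 2 ∨ d = 3) {w : Angle d → ℝ}
    (hw : MemLp w 2 (surf d)) {ε : ℝ} (hε : 0 < ε) :
    ∃ g ∈ ⨆ k, harmonics hd k, (eLpNorm (w - (g : Angle d → ℝ)) 2 (surf d)).toReal < ε := by
  have h1 : DenseRange (ContinuousMap.toLp 2 (surf d) ℝ : C(Angle d, ℝ) →L[ℝ] Lp ℝ 2 (surf d)) :=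
    ContinuousMap.toLp_denseRange ℝ (surf d) ℝ (by simp)
  have h2 : Dense ((⨆ k, harmonics hd k : Submodule ℝ C(Angle d, ℝ)) : Set C(Angle d, ℝ)) := by
    rw [Submodule.dense_iff_topologicalClosure_eq_top]
    exact iSup_harmonics_topologicalClosure hd
  have h3 := h1.dense_image (ContinuousLinearMap.continuous _) h2
  obtain ⟨_, hdist, ⟨g, hg, rfl⟩⟩ := Metric.dense_iff.1 h3 (hw.toLp w) ε hε
  refine ⟨g, hg, ?_⟩
  rw [Metric.mem_ball, dist_comm, Lp.dist_def] at hdist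
  convert hdist using 2
  exact eLpNorm_congr_ae (hw.coeFn_toLp.symm.sub (ContinuousMap.coeFn_toLp (surf d) g).symm)

/-! ### Square-integrable functions and Cauchy–Schwarz. -/

section L2

variable {α : Type*} [MeasurableSpace α] {m : Measure α} {f g : α → ℝ}

theorem integrable_mul_of_memLp_two (hf : MemLp f 2 m) (hg : MemLp g 2 m) :
    Integrable (fun x => f x * g x) m := hf.integrable_mul hg

theorem toReal_eLpNorm_two_sq (hf : MemLp f 2 m) :
    (eLpNorm f 2 m).toReal ^ 2 = ∫ x, f x ^ 2 ∂m := by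
  have h := L2.inner_def (𝕜 := ℝ) (hf.toLp f) (hf.toLp f)
  rw [real_inner_self_eq_norm_sq, Lp.norm_toLp] at h
  rw [h]
  refine integral_congr_ae ?_
  filter_upwards [hf.coeFn_toLp] with x hx
  rw [hx, real_inner_self_eq_norm_sq, Real.norm_eq_abs, sq_abs]

theorem toReal_eLpNorm_two_eq_sqrt (hf : MemLp f 2 m) :
    (eLpNorm f 2 m).toReal = √(∫ x, f x ^ 2 ∂m) := by
  rw [← toReal_eLpNorm_two_sq hf, Real.sqrt_sq ENNReal.toReal_nonneg]

theorem abs_integral_mul_le (hf : MemLp f 2 m) (hg : MemLp g 2 m) :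
    |∫ x, f x * g x ∂m| ≤ (eLpNorm f 2 m).toReal * (eLpNorm g 2 m).toReal := by
  have h := L2.inner_def (𝕜 := ℝ) (hg.toLp g) (hf.toLp f)
  have h1 := abs_real_inner_le_norm (hg.toLp g) (hf.toLp f)
  rw [Lp.norm_toLp, Lp.norm_toLp, mul_comm, h] at h1
  refine le_trans (le_of_eq ?_) h1
  congr 1
  refine integral_congr_ae ?_
  filter_upwards [hf.coeFn_toLp, hg.coeFn_toLp] with x hx hx'
  rw [hx, hx']
  rfl

theorem memLp_two_of_integrable_sq (hf : AEStronglyMeasurable f m)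
    (h : Integrable (fun x => f x ^ 2) m) : MemLp f 2 m :=
  (memLp_two_iff_integrable_sq hf).2 h

end L2

/-! ### Orthogonality between harmonics of different degree. -/

theorem memLp_surf_of_continuous {d : ℕ} {f : Angle d → ℝ} (hf : Continuous f) :
    MemLp f 2 (surf d) :=
  memLp_two_of_integrable_sq hf.aestronglyMeasurable
    (integrable_surf_of_continuous (hf.pow 2))

theorem harmonics_orthogonal {d : ℕ} (hd : d = 2 ∨ d = 3) {k ℓ : ℕ} (hkl : k ≠ ℓ)
    {f g : C(Angle d, ℝ)} (hf : f ∈ harmonics hd k) (hg : g ∈ harmonics hd ℓ) :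
    ∫ σ, f σ * g σ ∂(surf d) = 0 := by
  have hint (a b : C(Angle d, ℝ)) : Integrable (fun σ => a σ * b σ) (surf d) :=
    integrable_surf_of_continuous (a.continuous.mul b.continuous)
  induction hf using Submodule.span_induction with
  | zero => simp
  | add a b _ _ ha hb => simp [add_mul, integral_add (hint a g) (hint b g), ha, hb]
  | smul c a _ ha => simp [mul_assoc, integral_const_mul, ha]
  | mem a ha =>
    obtain ⟨μ, rfl⟩ := ha
    induction hg using Submodule.span_induction with
    | zero => simp
    | add a b _ _ ha hb => simp [mul_add, integral_add (hint _ a) (hint _ b), ha, hb]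
    | smul c a _ ha => simp [mul_left_comm _ c, integral_const_mul, ha]
    | mem a ha =>
      obtain ⟨ν, rfl⟩ := ha
      have := integral_normLegendre_mul hd k ℓ μ ν
      rw [if_neg hkl] at this
      exact this

/-- A finite combination of mutually orthogonal harmonics has square norm
`∑ (a_ℓ)² ‖g_ℓ‖²`. -/
theorem integral_sum_harmonics_sq {d : ℕ} (hd : d = 2 ∨ d = 3) (s : Finset ℕ) (a : ℕ → ℝ)
    (g : ℕ → C(Angle d, ℝ)) (hg : ∀ ℓ, g ℓ ∈ harmonics hd ℓ) :
    ∫ σ, (∑ ℓ ∈ s, a ℓ * g ℓ σ) ^ 2 ∂(surf d)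
      = ∑ ℓ ∈ s, a ℓ ^ 2 * ∫ σ, g ℓ σ ^ 2 ∂(surf d) := by
  have hint (k ℓ : ℕ) : Integrable (fun σ => a k * g k σ * (a ℓ * g ℓ σ)) (surf d) :=
    integrable_surf_of_continuous (by fun_prop)
  simp only [sq (Finset.sum _ _), Finset.sum_mul_sum]
  rw [integral_finsetSum _ fun k _ => integrable_finsetSum _ fun ℓ _ => hint k ℓ]
  refine Finset.sum_congr rfl fun k hk => ?_
  rw [integral_finsetSum _ fun ℓ _ => hint k ℓ, Finset.sum_eq_single_of_mem k hk]
  · rw [← integral_const_mul]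
    congr 1
    ext σ
    ring
  · intro ℓ _ hne
    have h := harmonics_orthogonal hd hne.symm (hg k) (hg ℓ)
    have : ∀ σ, a k * g k σ * (a ℓ * g ℓ σ) = (a k * a ℓ) * (g k σ * g ℓ σ) := fun σ => by ring
    simp only [this, integral_const_mul, h, mul_zero]

/-! ### Operators with zonal kernel on the sphere. -/

/-- A nonnegative integrable zonal kernel `f(μ·μ')` of total mass `β` on the sphere. -/
structure ZonalKernel (d : ℕ) (f : ℝ → ℝ) (β : ℝ) : Prop where
  measurable : Measurable f
  nonneg : ∀ t ∈ Set.Icc (-1 : ℝ) 1, 0 ≤ f t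
  integrable : ∀ μ : Angle d, Integrable (fun μ' => f (dotp μ μ')) (surf d)
  integral_eq : ∀ μ : Angle d, ∫ μ', f (dotp μ μ') ∂(surf d) = β

namespace ZonalKernel

variable {d : ℕ} {f : ℝ → ℝ} {β : ℝ}

theorem mass_nonneg (hf : ZonalKernel d f β) (μ : Angle d) : 0 ≤ β := by
  rw [← hf.integral_eq μ]
  exact integral_nonneg fun μ' => hf.nonneg _ (dotp_mem_Icc _ _)

theorem integral_sq_fst (hf : ZonalKernel d f β) {w : Angle d → ℝ} (hw : MemLp w 2 (surf d)) :
    Integrable (fun p : Angle d × Angle d => f (dotp p.2 p.1) * w p.2 ^ 2)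
      ((surf d).prod (surf d)) ∧
    ∫ p : Angle d × Angle d, f (dotp p.2 p.1) * w p.2 ^ 2 ∂((surf d).prod (surf d))
      = β * ∫ μ, w μ ^ 2 ∂(surf d) := by
  have hm : AEStronglyMeasurable (fun p : Angle d × Angle d => f (dotp p.2 p.1) * w p.2 ^ 2)
      ((surf d).prod (surf d)) :=
    ((hf.measurable.comp (continuous_dotp.comp continuous_swap).measurable).aestronglyMeasurable).mul
      ((hw.aestronglyMeasurable.comp_snd).pow 2)
  have hi : Integrable (fun p : Angle d × Angle d => f (dotp p.2 p.1) * w p.2 ^ 2)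
      ((surf d).prod (surf d)) := by
    refine (integrable_prod_iff' hm).2 ⟨Eventually.of_forall fun μ =>
      (hf.integrable μ).mul_const (w μ ^ 2), ?_⟩
    have : ∀ μ μ' : Angle d, ‖f (dotp μ μ') * w μ ^ 2‖ = f (dotp μ μ') * w μ ^ 2 := fun μ μ' =>
      Real.norm_of_nonneg (mul_nonneg (hf.nonneg _ (dotp_mem_Icc _ _)) (sq_nonneg _))
    simp only [this, integral_mul_const, hf.integral_eq]
    exact hw.integrable_sq.const_mul β
  refine ⟨hi, ?_⟩
  rw [integral_prod_symm _ hi]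
  simp only [integral_mul_const, hf.integral_eq, integral_const_mul]

/-- One half of a Schur test: f w v splits as (√f w)(√f v), and integrating out the variable absent
from w leaves the mass β. -/
theorem memLp_sqrt_snd (hf : ZonalKernel d f β) {w : Angle d → ℝ} (hw : MemLp w 2 (surf d)) :
    MemLp (fun p : Angle d × Angle d => √(f (dotp p.2 p.1)) * w p.2) 2 ((surf d).prod (surf d)) ∧
    (eLpNorm (fun p : Angle d × Angle d => √(f (dotp p.2 p.1)) * w p.2) 2
      ((surf d).prod (surf d))).toReal = √β * (eLpNorm w 2 (surf d)).toReal := by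
  have hm : AEStronglyMeasurable (fun p : Angle d × Angle d => √(f (dotp p.2 p.1)) * w p.2)
      ((surf d).prod (surf d)) :=
    ((hf.measurable.comp
      (continuous_dotp.comp continuous_swap).measurable).sqrt.aestronglyMeasurable).mul
      (hw.aestronglyMeasurable.comp_snd)
  have he : ∀ p : Angle d × Angle d,
      (√(f (dotp p.2 p.1)) * w p.2) ^ 2 = f (dotp p.2 p.1) * w p.2 ^ 2 := fun p => by
    rw [mul_pow, Real.sq_sqrt (hf.nonneg _ (dotp_mem_Icc _ _))]
  obtain ⟨h1, h2⟩ := hf.integral_sq_fst hw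
  have hL : MemLp (fun p : Angle d × Angle d => √(f (dotp p.2 p.1)) * w p.2) 2
      ((surf d).prod (surf d)) := memLp_two_of_integrable_sq hm (by simpa only [he] using h1)
  refine ⟨hL, ?_⟩
  rw [toReal_eLpNorm_two_eq_sqrt hL, toReal_eLpNorm_two_eq_sqrt hw]
  simp only [he, h2]
  exact Real.sqrt_mul' _ (integral_nonneg fun _ => sq_nonneg _)

theorem memLp_sqrt_fst (hf : ZonalKernel d f β) {v : Angle d → ℝ} (hv : MemLp v 2 (surf d)) :
    MemLp (fun p : Angle d × Angle d => √(f (dotp p.2 p.1)) * v p.1) 2 ((surf d).prod (surf d)) ∧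
    (eLpNorm (fun p : Angle d × Angle d => √(f (dotp p.2 p.1)) * v p.1) 2
      ((surf d).prod (surf d))).toReal = √β * (eLpNorm v 2 (surf d)).toReal := by
  obtain ⟨h1, h2⟩ := hf.memLp_sqrt_snd hv
  have hswap : MeasurePreserving (Prod.swap : Angle d × Angle d → _) ((surf d).prod (surf d))
      ((surf d).prod (surf d)) := Measure.measurePreserving_swap
  have he : (fun p : Angle d × Angle d => √(f (dotp p.2 p.1)) * v p.1) =
      (fun p : Angle d × Angle d => √(f (dotp p.2 p.1)) * v p.2) ∘ Prod.swap := by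
    funext p
    simp only [Function.comp, Prod.fst_swap, Prod.snd_swap]
    rw [dotp_comm]
  rw [he]
  exact ⟨h1.comp_measurePreserving hswap,
    by rw [eLpNorm_comp_measurePreserving h1.aestronglyMeasurable hswap, h2]⟩

theorem mul_sqrt (hf : ZonalKernel d f β) (w v : Angle d → ℝ) (p : Angle d × Angle d) :
    √(f (dotp p.2 p.1)) * w p.2 * (√(f (dotp p.2 p.1)) * v p.1)
      = f (dotp p.2 p.1) * w p.2 * v p.1 := by
  have := Real.mul_self_sqrt (hf.nonneg _ (dotp_mem_Icc p.2 p.1))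
  linear_combination w p.2 * v p.1 * this

theorem integrable_prod (hf : ZonalKernel d f β) {w v : Angle d → ℝ} (hw : MemLp w 2 (surf d))
    (hv : MemLp v 2 (surf d)) :
    Integrable (fun p : Angle d × Angle d => f (dotp p.2 p.1) * w p.2 * v p.1)
      ((surf d).prod (surf d)) := by
  have := integrable_mul_of_memLp_two (hf.memLp_sqrt_snd hw).1 (hf.memLp_sqrt_fst hv).1
  simpa only [hf.mul_sqrt] using this

/-- The bilinear form of a zonal kernel. -/
theorem integral_eq_prod (hf : ZonalKernel d f β) {w v : Angle d → ℝ} (hw : MemLp w 2 (surf d))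
    (hv : MemLp v 2 (surf d)) :
    ∫ μ, (∫ μ', f (dotp μ' μ) * w μ' ∂(surf d)) * v μ ∂(surf d)
      = ∫ p : Angle d × Angle d, f (dotp p.2 p.1) * w p.2 * v p.1 ∂((surf d).prod (surf d)) := by
  rw [integral_prod _ (hf.integrable_prod hw hv)]
  simp only [integral_mul_const]

/-- Cauchy–Schwarz for the two factors of the Schur test. This a priori bound serves both to bound
eigenvalues and to pass from harmonics to all of L². -/
theorem abs_form_le (hf : ZonalKernel d f β) {w v : Angle d → ℝ} (hw : MemLp w 2 (surf d))
    (hv : MemLp v 2 (surf d)) (μ : Angle d) :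
    |∫ μ, (∫ μ', f (dotp μ' μ) * w μ' ∂(surf d)) * v μ ∂(surf d)|
      ≤ β * ((eLpNorm w 2 (surf d)).toReal * (eLpNorm v 2 (surf d)).toReal) := by
  rw [hf.integral_eq_prod hw hv]
  obtain ⟨h1, h2⟩ := hf.memLp_sqrt_snd hw
  obtain ⟨h3, h4⟩ := hf.memLp_sqrt_fst hv
  have h := abs_integral_mul_le h1 h3
  simp only [hf.mul_sqrt] at h
  rw [h2, h4] at h
  refine h.trans (le_of_eq ?_)
  have := Real.mul_self_sqrt (hf.mass_nonneg μ)
  linear_combination (eLpNorm w 2 (surf d)).toReal * (eLpNorm v 2 (surf d)).toReal * this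

theorem form_sub (hf : ZonalKernel d f β) {w g v : Angle d → ℝ} (hw : MemLp w 2 (surf d))
    (hg : MemLp g 2 (surf d)) (hv : MemLp v 2 (surf d)) :
    ∫ μ, (∫ μ', f (dotp μ' μ) * (w - g) μ' ∂(surf d)) * v μ ∂(surf d)
      = ∫ μ, (∫ μ', f (dotp μ' μ) * w μ' ∂(surf d)) * v μ ∂(surf d)
        - ∫ μ, (∫ μ', f (dotp μ' μ) * g μ' ∂(surf d)) * v μ ∂(surf d) := by
  rw [hf.integral_eq_prod hw hv, hf.integral_eq_prod hg hv, hf.integral_eq_prod (hw.sub hg) hv,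
    ← integral_sub (hf.integrable_prod hw hv) (hf.integrable_prod hg hv)]
  congr 1
  ext p
  simp only [Pi.sub_apply]
  ring

theorem integrable_mul_continuous (hf : ZonalKernel d f β) (g : C(Angle d, ℝ)) (μ : Angle d) :
    Integrable (fun μ' => f (dotp μ' μ) * g μ') (surf d) := by
  simp only [dotp_comm _ μ]
  refine (hf.integrable μ).mul_bdd (c := ‖g‖) g.continuous.aestronglyMeasurable
    (Eventually.of_forall fun σ => g.norm_coe_le_norm σ)

/-- Spherical harmonics of degree `ℓ` are eigenfunctions if all zonal functions are. -/
theorem apply_harmonics (hf : ZonalKernel d f β) (hd : d = 2 ∨ d = 3) {ℓ : ℕ} {c : ℝ}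
    (h : ∀ μ ν : Angle d, ∫ μ', f (dotp μ' μ) * normLegendre d ℓ (dotp ν μ') ∂(surf d)
      = c * normLegendre d ℓ (dotp ν μ))
    {g : C(Angle d, ℝ)} (hg : g ∈ harmonics hd ℓ) (μ : Angle d) :
    ∫ μ', f (dotp μ' μ) * g μ' ∂(surf d) = c * g μ := by
  induction hg using Submodule.span_induction with
  | zero => simp
  | add a b _ _ ha hb =>
    simp only [ContinuousMap.add_apply, mul_add]
    rw [integral_add (hf.integrable_mul_continuous a μ) (hf.integrable_mul_continuous b μ), ha, hb]
  | smul r a _ ha =>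
    simp only [ContinuousMap.smul_apply, smul_eq_mul, mul_left_comm _ r, integral_const_mul, ha]
  | mem a ha =>
    obtain ⟨ν, rfl⟩ := ha
    exact h μ ν

/-- The eigenvalues of a zonal kernel are bounded by its mass. -/
theorem abs_eigenvalue_le (hf : ZonalKernel d f β) (hd : d = 2 ∨ d = 3) {ℓ : ℕ} {c : ℝ}
    (ν : Angle d)
    (h : ∀ μ ν : Angle d, ∫ μ', f (dotp μ' μ) * normLegendre d ℓ (dotp ν μ') ∂(surf d)
      = c * normLegendre d ℓ (dotp ν μ)) : |c| ≤ β := by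
  have hz : MemLp (zonal hd ℓ ν) 2 (surf d) := memLp_surf_of_continuous (zonal hd ℓ ν).continuous
  have h1 := hf.abs_form_le hz hz ν
  have h2 := fun μ => hf.apply_harmonics hd h (Submodule.subset_span (Set.mem_range_self ν)) μ
  -- By the reproducing property the zonal function has square norm P_ℓ(1) > 0, so testing the form
  -- on it gives |c| P_ℓ(1) ≤ β P_ℓ(1).
  have h3 : ∫ σ, zonal hd ℓ ν σ * zonal hd ℓ ν σ ∂(surf d) = normLegendre d ℓ 1 := by
    have := integral_normLegendre_mul hd ℓ ℓ ν ν
    rw [if_pos rfl, dotp_self] at this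
    exact this
  have hpos := normLegendre_one_pos hd ℓ
  rw [← sq (ENNReal.toReal _), toReal_eLpNorm_two_sq hz] at h1
  simp only [h2, sq, mul_assoc, integral_const_mul, h3, abs_mul, abs_of_pos hpos] at h1
  exact le_of_mul_le_mul_right h1 hpos

/-- A zonal kernel whose eigenvalues all lie within `R` of `c` differs from `c` times the identity
by an operator of norm at most `R`. -/
theorem abs_form_sub_le (hf : ZonalKernel d f β) (hd : d = 2 ∨ d = 3) {e : ℕ → ℝ}
    (h : ∀ ℓ, ∀ μ ν : Angle d, ∫ μ', f (dotp μ' μ) * normLegendre d ℓ (dotp ν μ') ∂(surf d)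
      = e ℓ * normLegendre d ℓ (dotp ν μ))
    {c R : ℝ} (hR : ∀ ℓ, |e ℓ - c| ≤ R) (μ₀ : Angle d) {w v : Angle d → ℝ}
    (hw : MemLp w 2 (surf d)) (hv : MemLp v 2 (surf d)) :
    |∫ μ, (∫ μ', f (dotp μ' μ) * w μ' ∂(surf d)) * v μ ∂(surf d) - c * ∫ μ, w μ * v μ ∂(surf d)|
      ≤ R * ((eLpNorm w 2 (surf d)).toReal * (eLpNorm v 2 (surf d)).toReal) := by
  have hR0 : 0 ≤ R := (abs_nonneg _).trans (hR 0)
  have hβ := hf.mass_nonneg μ₀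
  -- On a finite sum of harmonics the operator minus c multiplies the component of degree ℓ by e_ℓ -
  -- c; orthogonality (Pythagoras) then bounds its norm by R.
  have hharm : ∀ g ∈ ⨆ k, harmonics hd k,
      |∫ μ, (∫ μ', f (dotp μ' μ) * g μ' ∂(surf d)) * v μ ∂(surf d)
        - c * ∫ μ, g μ * v μ ∂(surf d)|
      ≤ R * ((eLpNorm g 2 (surf d)).toReal * (eLpNorm v 2 (surf d)).toReal) := by
    intro g hg
    obtain ⟨G, hG, hGg⟩ := (Submodule.mem_iSup_iff_exists_finsupp _ _).1 hg
    have hgL : MemLp g 2 (surf d) :=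
      memLp_surf_of_continuous g.continuous
    have hsum : ∀ σ, g σ = ∑ ℓ ∈ G.support, G ℓ σ := fun σ => by
      rw [← hGg, Finsupp.sum, ContinuousMap.sum_apply]
    let k : Angle d → ℝ := fun σ => ∑ ℓ ∈ G.support, (e ℓ - c) * G ℓ σ
    have hkc : Continuous k := by fun_prop
    have hkL : MemLp k 2 (surf d) := memLp_surf_of_continuous hkc
    have hK : ∀ μ, ∫ μ', f (dotp μ' μ) * g μ' ∂(surf d)
        = k μ + c * g μ := by
      intro μ
      simp only [hsum, Finset.mul_sum]
      rw [integral_finsetSum _ fun ℓ _ => hf.integrable_mul_continuous (G ℓ) μ,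
        ← Finset.sum_add_distrib]
      refine Finset.sum_congr rfl fun ℓ _ => ?_
      rw [hf.apply_harmonics hd (h ℓ) (hG ℓ)]
      ring
    have hform : ∫ μ, (∫ μ', f (dotp μ' μ) * g μ' ∂(surf d)) * v μ ∂(surf d)
        - c * ∫ μ, g μ * v μ ∂(surf d) = ∫ μ, k μ * v μ ∂(surf d) := by
      simp only [hK, add_mul, mul_assoc]
      rw [integral_add (integrable_mul_of_memLp_two hkL hv)
        ((integrable_mul_of_memLp_two hgL hv).const_mul c), integral_const_mul, add_sub_cancel_right]
    have hnorm : (eLpNorm k 2 (surf d)).toReal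
        ≤ R * (eLpNorm g 2 (surf d)).toReal := by
      refine le_of_sq_le_sq ?_ (by positivity)
      rw [mul_pow, toReal_eLpNorm_two_sq hkL, toReal_eLpNorm_two_sq hgL]
      have h1 := integral_sum_harmonics_sq hd G.support (fun ℓ => e ℓ - c) G hG
      have h2 := integral_sum_harmonics_sq hd G.support (fun _ => 1) G hG
      simp only [one_mul, one_pow] at h2
      simp only [hsum, k]
      rw [h1, h2, Finset.mul_sum]
      refine Finset.sum_le_sum fun ℓ _ => ?_
      refine mul_le_mul_of_nonneg_right ?_ (integral_nonneg fun _ => sq_nonneg _)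
      rw [← sq_abs (e ℓ - c)]
      exact pow_le_pow_left₀ (abs_nonneg _) (hR ℓ) 2
    rw [hform, ← mul_assoc]
    exact (abs_integral_mul_le hkL hv).trans
      (mul_le_mul_of_nonneg_right hnorm ENNReal.toReal_nonneg)
  set W := (eLpNorm w 2 (surf d)).toReal with hW
  set V := (eLpNorm v 2 (surf d)).toReal with hV
  have hV0 : 0 ≤ V := ENNReal.toReal_nonneg
  -- Replacing w by a harmonic approximant costs ε three times: R through the norm of the
  -- approximant, β through the kernel form and |c| through the inner product.
  have key : ∀ ε > 0, |∫ μ, (∫ μ', f (dotp μ' μ) * w μ' ∂(surf d)) * v μ ∂(surf d)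
      - c * ∫ μ, w μ * v μ ∂(surf d)| ≤ R * (W * V) + ε * ((R + β + |c|) * V) := by
    intro ε hε
    obtain ⟨g, hg, hgε⟩ := exists_harmonics_eLpNorm_sub_le hd hw hε
    have hgL : MemLp g 2 (surf d) := memLp_surf_of_continuous g.continuous
    have hdL := hw.sub hgL
    have h1 := hharm g hg
    have h2 := hf.abs_form_le hdL hv μ₀
    rw [hf.form_sub hw hgL hv] at h2
    have h3 := abs_integral_mul_le hdL hv
    simp only [Pi.sub_apply, sub_mul] at h3
    rw [integral_sub (integrable_mul_of_memLp_two hw hv) (integrable_mul_of_memLp_two hgL hv)] at h3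
    have h4 : (eLpNorm g 2 (surf d)).toReal ≤ W + ε := by
      have h5 : eLpNorm g 2 (surf d) ≤ eLpNorm w 2 (surf d)
          + eLpNorm (w - (g : Angle d → ℝ)) 2 (surf d) := by
        have := eLpNorm_sub_le (p := 2) hw.aestronglyMeasurable hdL.aestronglyMeasurable (by simp)
        rwa [sub_sub_cancel] at this
      have h6 := ENNReal.toReal_mono (by
        exact ENNReal.add_ne_top.2 ⟨hw.eLpNorm_ne_top, hdL.eLpNorm_ne_top⟩) h5
      rw [ENNReal.toReal_add hw.eLpNorm_ne_top hdL.eLpNorm_ne_top] at h6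
      linarith
    set Δ := (eLpNorm (w - (g : Angle d → ℝ)) 2 (surf d)).toReal
    set s := ∫ μ, (∫ μ', f (dotp μ' μ) * w μ' ∂(surf d)) * v μ ∂(surf d)
    set s' := ∫ μ, (∫ μ', f (dotp μ' μ) * g μ' ∂(surf d)) * v μ ∂(surf d)
    set i := ∫ μ, w μ * v μ ∂(surf d)
    set i' := ∫ μ, g μ * v μ ∂(surf d)
    have e1 : s - c * i = (s' - c * i') + (s - s') - c * (i - i') := by ring
    have e2 : |s - c * i| ≤ |s' - c * i'| + |s - s'| + |c| * |i - i'| := by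
      rw [e1, ← abs_mul]
      exact (abs_sub _ _).trans (add_le_add_left (abs_add_le _ _) _)
    have e3 : |s' - c * i'| ≤ R * ((W + ε) * V) := h1.trans (by gcongr)
    have e4 : |s - s'| ≤ β * (ε * V) := h2.trans (by gcongr)
    have e5 : |c| * |i - i'| ≤ |c| * (ε * V) := by
      gcongr
      exact h3.trans (by gcongr)
    linarith
  refine le_of_forall_pos_le_add fun δ hδ => ?_
  have hq : 0 ≤ (R + β + |c|) * V := by positivity
  -- The summand 1 keeps the denominator positive when (R + β + |c|) V is zero.
  refine (key (δ / ((R + β + |c|) * V + 1)) (by positivity)).trans ?_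
  gcongr
  rw [div_mul_eq_mul_div, div_le_iff₀ (by positivity)]
  nlinarith

end ZonalKernel

/-! ### Legendre coefficients as eigenvalues. -/

theorem nonempty_angle {d : ℕ} (hd : d = 2 ∨ d = 3) : Nonempty (Angle d) := by
  have : Nonempty (Fin d) := ⟨⟨0, by omega⟩⟩
  obtain ⟨z, hz⟩ := exists_norm_eq (Space d) zero_le_one
  exact ⟨⟨z, by simpa using hz⟩⟩

/-- The Funk–Hecke formula: the coefficients of the Legendre expansion are the eigenvalues of the
scattering kernel. -/
theorem HasLegendreExpansion.eigenvalue {d : ℕ} (hd : d = 2 ∨ d = 3) {D : Set (Space d)}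
    {θ : Space d → ℝ → ℝ} {θc : ℕ → Space d → ℝ} (hexp : HasLegendreExpansion D θ θc)
    {x : Space d} (hx : x ∈ D) (ℓ : ℕ) (μ ν : Angle d) :
    ∫ μ', θ x (dotp μ' μ) * normLegendre d ℓ (dotp ν μ') ∂(surf d)
      = θc ℓ x * normLegendre d ℓ (dotp ν μ) := by
  have hg : ContDiff ℝ ((⊤ : ℕ∞) : WithTop ℕ∞)
      (fun y : Space d => normLegendre d ℓ (inner ℝ (ν : Space d) y)) :=
    (contDiff_normLegendre hd ℓ).comp (contDiff_const.inner ℝ contDiff_id)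
  have h := hexp x hx μ _ hg
  -- The test function is the zonal polynomial of degree ℓ, extended smoothly to the whole space. By
  -- orthogonality the tested partial sums are constant once N > ℓ, so their limit is known.
  have hterm : ∀ N, ℓ < N → ∫ μ' : Angle d,
      (∑ k ∈ Finset.range N, θc k x * normLegendre d k (dotp μ μ')) *
        normLegendre d ℓ (inner ℝ (ν : Space d) (μ' : Space d)) ∂(surf d)
      = θc ℓ x * normLegendre d ℓ (dotp ν μ) := by
    intro N hN
    have hint (k : ℕ) : Integrable (fun μ' : Angle d => θc k x *
        (normLegendre d k (dotp μ μ') * normLegendre d ℓ (dotp ν μ'))) (surf d) :=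
      (integrable_surf_of_continuous (((continuous_normLegendre hd k).comp
        (continuous_dotp_right μ)).mul ((continuous_normLegendre hd ℓ).comp
        (continuous_dotp_right ν)))).const_mul _
    change ∫ μ' : Angle d, (∑ k ∈ Finset.range N, θc k x * normLegendre d k (dotp μ μ')) *
        normLegendre d ℓ (dotp ν μ') ∂(surf d) = _
    simp only [Finset.sum_mul, mul_assoc]
    rw [integral_finsetSum _ fun k _ => hint k]
    simp only [integral_const_mul, integral_normLegendre_mul hd]
    rw [Finset.sum_eq_single_of_mem ℓ (Finset.mem_range.2 hN)
      (fun k _ hk => by rw [if_neg hk, mul_zero]), if_pos rfl, dotp_comm μ ν]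
  have hlim := tendsto_nhds_unique h
    (tendsto_const_nhds.congr' ((eventually_gt_atTop ℓ).mono fun N hN => (hterm N hN).symm))
  simp only [dotp_comm μ] at hlim
  exact hlim

/-! ### Integrability and Fubini on phase space. -/

theorem zonalKernel_of_mem {d : ℕ} {D : Set (Space d)} {θ : Space d → ℝ → ℝ}
    (hθ_meas : Measurable (fun p : Space d × ℝ => θ p.1 p.2))
    (hθ_nonneg : ∀ x ∈ D, ∀ t ∈ Set.Icc (-1 : ℝ) 1, 0 ≤ θ x t)
    (hθ_int : ∀ x ∈ D, ∀ μ : Angle d, Integrable (fun μ' => θ x (dotp μ μ')) (surf d))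
    {x : Space d} (hx : x ∈ D) : ZonalKernel d (θ x) (crossSection θ x) where
  measurable := hθ_meas.comp measurable_prodMk_left
  nonneg := hθ_nonneg x hx
  integrable := hθ_int x hx
  integral_eq μ := (crossSection_eq θ x μ).symm

theorem measurable_crossSection {d : ℕ} (hd : d = 2 ∨ d = 3) {θ : Space d → ℝ → ℝ}
    (hθ_meas : Measurable (fun p : Space d × ℝ => θ p.1 p.2)) :
    Measurable (crossSection θ) := by
  obtain ⟨μ₀⟩ := nonempty_angle hd
  rw [show crossSection θ = fun x => ∫ μ', θ x (dotp μ₀ μ') ∂(surf d) from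
    funext fun x => crossSection_eq θ x μ₀]
  have : Measurable fun p : Space d × Angle d => θ p.1 (dotp μ₀ p.2) :=
    hθ_meas.comp (measurable_fst.prodMk ((continuous_dotp_right μ₀).measurable.comp measurable_snd))
  exact this.stronglyMeasurable.integral_prod_right'.measurable

theorem ae_phaseMeasure_mem {d : ℕ} {D : Set (Space d)} (hD : IsOpen D) :
    ∀ᵐ p ∂(phaseMeasure d D), p.1 ∈ D :=
  Measure.quasiMeasurePreserving_fst.ae (ae_restrict_mem hD.measurableSet)

/-- Exchange of the two directions in phase space. -/
theorem measurePreserving_exchange (d : ℕ) (D : Set (Space d)) :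
    MeasurePreserving (fun q : (Space d × Angle d) × Angle d => ((q.1.1, q.2), q.1.2))
      ((phaseMeasure d D).prod (surf d)) ((phaseMeasure d D).prod (surf d)) := by
  have h1 := measurePreserving_prodAssoc ((volume : Measure (Space d)).restrict D) (surf d) (surf d)
  have h2 := (MeasurePreserving.id ((volume : Measure (Space d)).restrict D)).prod
    (Measure.measurePreserving_swap (μ := surf d) (ν := surf d))
  exact (h1.symm _).comp (h2.comp h1)

theorem ae_memLp_slice {d : ℕ} {D : Set (Space d)} {w : Space d × Angle d → ℝ}
    (hw : MemLp w 2 (phaseMeasure d D)) :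
    ∀ᵐ x ∂((volume : Measure (Space d)).restrict D), MemLp (fun μ => w (x, μ)) 2 (surf d) := by
  have h1 : Integrable (fun p => w p ^ 2) (phaseMeasure d D) := hw.integrable_sq
  have h2 := hw.aestronglyMeasurable
  unfold phaseMeasure at h1 h2
  filter_upwards [h1.prod_right_ae, h2.prodMk_left] with x hx hx'
  exact memLp_two_of_integrable_sq hx' hx

section Forms

variable {d : ℕ} {D : Set (Space d)} {θ : Space d → ℝ → ℝ}

theorem integrable_crossSection_mul (hd : d = 2 ∨ d = 3) (hD : IsOpen D)
    (hθ_meas : Measurable (fun p : Space d × ℝ => θ p.1 p.2))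
    (hθ_nonneg : ∀ x ∈ D, ∀ t ∈ Set.Icc (-1 : ℝ) 1, 0 ≤ θ x t)
    (hθ_int : ∀ x ∈ D, ∀ μ : Angle d, Integrable (fun μ' => θ x (dotp μ μ')) (surf d))
    (hβ : ∃ C : ℝ, ∀ᵐ x ∂((volume : Measure (Space d)).restrict D), crossSection θ x ≤ C)
    {w v : Space d × Angle d → ℝ} (hw : MemLp w 2 (phaseMeasure d D))
    (hv : MemLp v 2 (phaseMeasure d D)) :
    Integrable (fun p : Space d × Angle d => crossSection θ p.1 * w p * v p)
      (phaseMeasure d D) := by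
  obtain ⟨C, hC⟩ := hβ
  obtain ⟨μ₀⟩ := nonempty_angle hd
  simp only [mul_assoc]
  refine (integrable_mul_of_memLp_two hw hv).bdd_mul (c := C)
    ((measurable_crossSection hd hθ_meas).comp measurable_fst).aestronglyMeasurable ?_
  have hC' : ∀ᵐ p ∂(phaseMeasure d D), crossSection θ p.1 ≤ C :=
    Measure.quasiMeasurePreserving_fst.ae hC
  filter_upwards [hC', ae_phaseMeasure_mem hD] with p hp hpD
  rwa [Real.norm_of_nonneg ((zonalKernel_of_mem hθ_meas hθ_nonneg hθ_int hpD).mass_nonneg μ₀)]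

/-- The Schur splitting on phase space: integrating the square over μ' gives β v², which is
integrable because β is essentially bounded. -/
theorem memLp_sqrt_kernel_mul (hd : d = 2 ∨ d = 3) (hD : IsOpen D)
    (hθ_meas : Measurable (fun p : Space d × ℝ => θ p.1 p.2))
    (hθ_nonneg : ∀ x ∈ D, ∀ t ∈ Set.Icc (-1 : ℝ) 1, 0 ≤ θ x t)
    (hθ_int : ∀ x ∈ D, ∀ μ : Angle d, Integrable (fun μ' => θ x (dotp μ μ')) (surf d))
    (hβ : ∃ C : ℝ, ∀ᵐ x ∂((volume : Measure (Space d)).restrict D), crossSection θ x ≤ C)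
    {v : Space d × Angle d → ℝ} (hv : MemLp v 2 (phaseMeasure d D)) :
    MemLp (fun q : (Space d × Angle d) × Angle d => √(θ q.1.1 (dotp q.2 q.1.2)) * v q.1) 2
      ((phaseMeasure d D).prod (surf d)) := by
  have : SFinite (phaseMeasure d D) := by unfold phaseMeasure; infer_instance
  have hm : Measurable fun q : (Space d × Angle d) × Angle d => θ q.1.1 (dotp q.2 q.1.2) :=
    hθ_meas.comp ((measurable_fst.comp measurable_fst).prodMk (continuous_dotp.measurable.comp
      (measurable_snd.prodMk (measurable_snd.comp measurable_fst))))
  have hFm : AEStronglyMeasurable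
      (fun q : (Space d × Angle d) × Angle d => √(θ q.1.1 (dotp q.2 q.1.2)) * v q.1)
      ((phaseMeasure d D).prod (surf d)) :=
    hm.sqrt.aestronglyMeasurable.mul hv.aestronglyMeasurable.comp_fst
  refine memLp_two_of_integrable_sq hFm ((integrable_prod_iff (hFm.pow 2)).2 ⟨?_, ?_⟩)
  all_goals
    have hslice : ∀ᵐ p ∂(phaseMeasure d D), (fun μ' : Angle d =>
        (√(θ p.1 (dotp μ' p.2)) * v p) ^ 2) = fun μ' => θ p.1 (dotp p.2 μ') * v p ^ 2 := by
      filter_upwards [ae_phaseMeasure_mem hD] with p hp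
      funext μ'
      rw [mul_pow, Real.sq_sqrt (hθ_nonneg _ hp _ (dotp_mem_Icc _ _)), dotp_comm]
  · filter_upwards [hslice, ae_phaseMeasure_mem hD] with p hp hpD
    change Integrable (fun μ' : Angle d => (√(θ p.1 (dotp μ' p.2)) * v p) ^ 2) (surf d)
    rw [hp]
    exact (hθ_int _ hpD _).mul_const _
  · refine (integrable_crossSection_mul hd hD hθ_meas hθ_nonneg hθ_int hβ hv hv).congr ?_
    filter_upwards [hslice] with p hp
    change _ = ∫ μ' : Angle d, ‖(√(θ p.1 (dotp μ' p.2)) * v p) ^ 2‖ ∂(surf d)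
    simp only [Real.norm_of_nonneg (sq_nonneg _)]
    rw [hp, integral_mul_const, ← crossSection_eq]
    ring

/-- The integrand is (√θ w)(√θ v); the factor with w is the one with v after the two directions are
exchanged, and θ is symmetric under that exchange. -/
theorem integrable_scatter (hd : d = 2 ∨ d = 3) (hD : IsOpen D)
    (hθ_meas : Measurable (fun p : Space d × ℝ => θ p.1 p.2))
    (hθ_nonneg : ∀ x ∈ D, ∀ t ∈ Set.Icc (-1 : ℝ) 1, 0 ≤ θ x t)
    (hθ_int : ∀ x ∈ D, ∀ μ : Angle d, Integrable (fun μ' => θ x (dotp μ μ')) (surf d))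
    (hβ : ∃ C : ℝ, ∀ᵐ x ∂((volume : Measure (Space d)).restrict D), crossSection θ x ≤ C)
    {w v : Space d × Angle d → ℝ} (hw : MemLp w 2 (phaseMeasure d D))
    (hv : MemLp v 2 (phaseMeasure d D)) :
    Integrable (fun q : (Space d × Angle d) × Angle d =>
        θ q.1.1 (dotp q.2 q.1.2) * w (q.1.1, q.2) * v q.1)
      ((phaseMeasure d D).prod (surf d)) := by
  have hL {u : Space d × Angle d → ℝ} (hu : MemLp u 2 (phaseMeasure d D)) :=
    memLp_sqrt_kernel_mul hd hD hθ_meas hθ_nonneg hθ_int hβ hu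
  have h1 := (hL hw).comp_measurePreserving (measurePreserving_exchange d D)
  refine (integrable_mul_of_memLp_two h1 (hL hv)).congr ?_
  have hmem : ∀ᵐ q ∂((phaseMeasure d D).prod (surf d)), q.1.1 ∈ D :=
    Measure.quasiMeasurePreserving_fst.ae (ae_phaseMeasure_mem hD)
  filter_upwards [hmem] with q hq
  have := Real.mul_self_sqrt (hθ_nonneg _ hq _ (dotp_mem_Icc q.2 q.1.2))
  simp only [Function.comp, dotp_comm q.1.2 q.2]
  linear_combination w (q.1.1, q.2) * v q.1 * this

/-- Fubini, with x as the outer variable: the spherical estimate acts on the slice at each x. -/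
theorem scatterForm_eq {w v : Space d × Angle d → ℝ}
    (h : Integrable (fun q : (Space d × Angle d) × Angle d =>
        θ q.1.1 (dotp q.2 q.1.2) * w (q.1.1, q.2) * v q.1) ((phaseMeasure d D).prod (surf d))) :
    Integrable (fun x => ∫ μ, scatterOp θ w x μ * v (x, μ) ∂(surf d)) (volume.restrict D) ∧
    scatterForm D θ w v = ∫ x in D, ∫ μ, scatterOp θ w x μ * v (x, μ) ∂(surf d) := by
  have : SFinite (phaseMeasure d D) := by unfold phaseMeasure; infer_instance
  have h1 := h.integral_prod_left
  simp only [integral_mul_const] at h1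
  have h2 : Integrable (fun p : Space d × Angle d => scatterOp θ w p.1 p.2 * v p)
      ((volume.restrict D).prod (surf d)) := h1
  refine ⟨h2.integral_prod_left, ?_⟩
  exact (integral_integral_swap (f := fun x μ => scatterOp θ w x μ * v (x, μ)) h2).symm

theorem massForm_eq {w v : Space d × Angle d → ℝ}
    (h : Integrable (fun p : Space d × Angle d => crossSection θ p.1 * w p * v p)
      (phaseMeasure d D)) :
    Integrable (fun x => crossSection θ x * ∫ μ, w (x, μ) * v (x, μ) ∂(surf d))
      (volume.restrict D) ∧
    massForm D θ w v = ∫ x in D, crossSection θ x * ∫ μ, w (x, μ) * v (x, μ) ∂(surf d) := by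
  have h2 : Integrable (fun p : Space d × Angle d => crossSection θ p.1 * (w p * v p))
      ((volume.restrict D).prod (surf d)) := by
    simp only [mul_assoc] at h
    exact h
  constructor
  · simpa only [integral_const_mul] using h2.integral_prod_left
  · simp only [massForm, mul_assoc, ← integral_const_mul]
    exact (integral_integral_swap
      (f := fun x μ => crossSection θ x * (w (x, μ) * v (x, μ))) h2).symm

/-- The slice norms `x ↦ (β(x) ∫ w(x, μ)² dμ)^{1/2}` are square integrable, and their norm is
`m(w, w)^{1/2}`. -/
theorem memLp_sqrt_slice (hd : d = 2 ∨ d = 3) (hD : IsOpen D)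
    (hθ_meas : Measurable (fun p : Space d × ℝ => θ p.1 p.2))
    (hθ_nonneg : ∀ x ∈ D, ∀ t ∈ Set.Icc (-1 : ℝ) 1, 0 ≤ θ x t)
    (hθ_int : ∀ x ∈ D, ∀ μ : Angle d, Integrable (fun μ' => θ x (dotp μ μ')) (surf d))
    (hβ : ∃ C : ℝ, ∀ᵐ x ∂((volume : Measure (Space d)).restrict D), crossSection θ x ≤ C)
    {w : Space d × Angle d → ℝ} (hw : MemLp w 2 (phaseMeasure d D)) :
    MemLp (fun x => √(crossSection θ x * ∫ μ, w (x, μ) * w (x, μ) ∂(surf d))) 2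
      (volume.restrict D) ∧
    (eLpNorm (fun x => √(crossSection θ x * ∫ μ, w (x, μ) * w (x, μ) ∂(surf d))) 2
      (volume.restrict D)).toReal = massForm D θ w w ^ (1 / 2 : ℝ) := by
  obtain ⟨μ₀⟩ := nonempty_angle hd
  obtain ⟨h1, h2⟩ := massForm_eq
    (integrable_crossSection_mul hd hD hθ_meas hθ_nonneg hθ_int hβ hw hw)
  have hsq : (fun x => √(crossSection θ x * ∫ μ, w (x, μ) * w (x, μ) ∂(surf d)) ^ 2)
      =ᵐ[volume.restrict D] fun x => crossSection θ x * ∫ μ, w (x, μ) * w (x, μ) ∂(surf d) := by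
    filter_upwards [ae_restrict_mem hD.measurableSet] with x hx
    exact Real.sq_sqrt (mul_nonneg
      ((zonalKernel_of_mem hθ_meas hθ_nonneg hθ_int hx).mass_nonneg μ₀)
      (integral_nonneg fun μ => mul_self_nonneg _))
  have hL : MemLp (fun x => √(crossSection θ x * ∫ μ, w (x, μ) * w (x, μ) ∂(surf d))) 2
      (volume.restrict D) :=
    memLp_two_of_integrable_sq
      (Real.continuous_sqrt.comp_aestronglyMeasurable h1.aestronglyMeasurable) (h1.congr hsq.symm)
  refine ⟨hL, ?_⟩
  rw [toReal_eLpNorm_two_eq_sqrt hL, integral_congr_ae hsq, ← h2, Real.sqrt_eq_rpow]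

end Forms

/-! ### The estimate on phase space. -/

theorem mainTheorem4 (d : ℕ) (hd : d = 2 ∨ d = 3)
    (D : Set (Space d)) (hD : IsOpen D)
    (θ : Space d → ℝ → ℝ)
    (hθ_meas : Measurable (fun p : Space d × ℝ => θ p.1 p.2))
    (hθ_nonneg : ∀ x ∈ D, ∀ t ∈ Set.Icc (-1 : ℝ) 1, 0 ≤ θ x t)
    (hθ_int : ∀ x ∈ D, ∀ μ : Angle d, Integrable (fun μ' => θ x (dotp μ μ')) (surf d))
    (hβ : ∃ C : ℝ, ∀ᵐ x ∂((volume : Measure (Space d)).restrict D), crossSection θ x ≤ C)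
    (θc : ℕ → Space d → ℝ)
    (hexp : HasLegendreExpansion D θ θc)
    (ω : ℝ) :
    BddAbove (deviations D θ θc ω) ∧
    ∀ w v : Space d × Angle d → ℝ,
      MemLp w 2 (phaseMeasure d D) → MemLp v 2 (phaseMeasure d D) →
      Integrable (fun q : (Space d × Angle d) × Angle d =>
          θ q.1.1 (dotp q.2 q.1.2) * w (q.1.1, q.2) * v q.1)
        ((phaseMeasure d D).prod (surf d)) ∧
      Integrable (fun p : Space d × Angle d => crossSection θ p.1 * w p * v p)
        (phaseMeasure d D) ∧
      |scatterForm D θ w v - ω * massForm D θ w v| ≤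
        contractionFactor D θ θc ω *
          (massForm D θ w w) ^ (1 / 2 : ℝ) * (massForm D θ v v) ^ (1 / 2 : ℝ) := by
  obtain ⟨μ₀⟩ := nonempty_angle hd
  have hker {x : Space d} (hx : x ∈ D) := zonalKernel_of_mem hθ_meas hθ_nonneg hθ_int hx
  have hcoef : ∀ x ∈ D, ∀ ℓ, |θc ℓ x| ≤ crossSection θ x := fun x hx ℓ =>
    (hker hx).abs_eigenvalue_le hd μ₀ (hexp.eigenvalue hd hx ℓ)
  have hbdd : BddAbove (deviations D θ θc ω) := by
    refine ⟨1 + |ω|, ?_⟩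
    rintro _ ⟨ℓ, x, hx, rfl⟩
    refine (abs_sub _ _).trans (add_le_add_left ?_ _)
    rw [abs_div, abs_of_nonneg ((hker hx).mass_nonneg μ₀)]
    exact div_le_one_of_le₀ (hcoef x hx ℓ) ((hker hx).mass_nonneg μ₀)
  refine ⟨hbdd, fun w v hw hv => ?_⟩
  have hI := integrable_scatter hd hD hθ_meas hθ_nonneg hθ_int hβ hw hv
  have hM := integrable_crossSection_mul hd hD hθ_meas hθ_nonneg hθ_int hβ hw hv
  refine ⟨hI, hM, ?_⟩
  set r := contractionFactor D θ θc ω with hr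
  -- Where β(x) = 0 the bound |θ_ℓ(x)| ≤ β(x) forces θ_ℓ(x) = 0, so the value assigned to the
  -- quotient there does no harm.
  have hdev : ∀ x ∈ D, ∀ ℓ, |θc ℓ x - ω * crossSection θ x| ≤ r * crossSection θ x := by
    intro x hx ℓ
    have h1 : |θc ℓ x / crossSection θ x - ω| ≤ r := le_csSup hbdd ⟨ℓ, x, hx, rfl⟩
    rcases ((hker hx).mass_nonneg μ₀).eq_or_lt with h0 | hpos
    · have h2 := hcoef x hx ℓ
      rw [← h0] at h2 ⊢
      simpa using h2
    · have h3 : θc ℓ x - ω * crossSection θ x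
          = (θc ℓ x / crossSection θ x - ω) * crossSection θ x := by field_simp
      rw [h3, abs_mul, abs_of_pos hpos]
      gcongr
  obtain ⟨hs1, hs2⟩ := scatterForm_eq hI
  obtain ⟨hm1, hm2⟩ := massForm_eq hM
  obtain ⟨hW1, hW2⟩ := memLp_sqrt_slice hd hD hθ_meas hθ_nonneg hθ_int hβ hw
  obtain ⟨hV1, hV2⟩ := memLp_sqrt_slice hd hD hθ_meas hθ_nonneg hθ_int hβ hv
  have hr0 : 0 ≤ r := Real.sSup_nonneg (by
    rintro _ ⟨ℓ, x, hx, rfl⟩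
    exact abs_nonneg _)
  rw [hs2, hm2, ← integral_const_mul, ← integral_sub hs1 (hm1.const_mul ω), ← hW2, ← hV2,
    mul_assoc, ← Real.norm_eq_abs]
  -- On almost every slice the spherical estimate applies with eigenvalues θ_ℓ(x), centre ωβ(x) and
  -- radius rβ(x). The factor β is shared as √β √β between w and v, and Cauchy–Schwarz in x
  -- finishes.
  refine le_trans (norm_integral_le_of_norm_le
    ((integrable_mul_of_memLp_two hW1 hV1).const_mul r) ?_) ?_
  · filter_upwards [ae_restrict_mem hD.measurableSet, ae_memLp_slice hw, ae_memLp_slice hv]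
      with x hx hwx hvx
    have h := (hker hx).abs_form_sub_le hd (hexp.eigenvalue hd hx) (hdev x hx) μ₀ hwx hvx
    have hβ0 := (hker hx).mass_nonneg μ₀
    have hβ2 := Real.mul_self_sqrt hβ0
    rw [toReal_eLpNorm_two_eq_sqrt hwx, toReal_eLpNorm_two_eq_sqrt hvx] at h
    rw [Real.sqrt_mul hβ0, Real.sqrt_mul hβ0, Real.norm_eq_abs]
    simp only [← sq]
    rw [← mul_assoc ω]
    refine h.trans (le_of_eq ?_)
    linear_combination -r * √(∫ μ, w (x, μ) ^ 2 ∂(surf d)) * √(∫ μ, v (x, μ) ^ 2 ∂(surf d)) * hβ2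
  · rw [integral_const_mul]
    gcongr
    exact (le_abs_self _).trans (abs_integral_mul_le hW1 hV1)
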